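/- Let $\mathcal H$ be an infinite dimensional complex Hilbert space, with scalar product $\langle\cdot|\cdot\rangle$ antilinear in the first variable. Let $\Gamma(\mathcal H)=\bigoplus_{n\ge 0}\mathcal H^{\vee n}$ be the bosonic Fock space over $\mathcal H$: the Hilbert space direct sum of the symmetric powers $\mathcal H^{\vee n}$, where $\mathcal H^{\vee n}$ is the Hilbert space spanned by the commutative products $u_1\cdots u_n$ of vectors of $\mathcal H$, with $$\langle u_1\cdots u_n\,|\,v_1\cdots v_n\rangle=\sum_{\sigma\in S_n}\prod_{i=1}^n\langle u_i|v_{\sigma(i)}\rangle .$$ For $u\in\mathcal H$ let $a^*(u)$ be the operator of multiplication by $u$ on the finite particle vectors, $a(u)$ its adjoint, $\phi(u)=a(u)+a^*(u)$ the field operator and $W(u)=e^{i\phi(u)}$ the corresponding unitary operator on $\Gamma(\mathcal H)$. For a contraction $A$ on $\mathcal H$ let $\Gamma(A)$ be the bounded operator on $\Gamma(\mathcal H)$ with $\Gamma(A)(u_1\cdots u_n)=(Au_1)\cdots(Au_n)$. Let $N$ be the number operator, equal to $n$ on $\mathcal H^{\vee n}$. Let $C_0(\mathbb N)$ be the algebra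 of complex functions on $\mathbb N=\{0,1,2,\dots\}$ which tend to zero at infinity, and let $\theta(N)$ be the operator of multiplication by $\theta(n)$ on $\mathcal H^{\vee n}$. For a $*$-algebra $\mathcal O$ of bounded operators on $\mathcal H$, let $\mathscr F(\mathcal O)$ be the $C^*$-algebra of operators on $\Gamma(\mathcal H)$ generated by the operators $W(u)\Gamma(A)$ with $u\in\mathcal H$, $A\in\mathcal O$, $\|A\|<1$. Let $\mathscr A(\mathcal H)=\mathscr F(\mathbb C 1_{\mathcal H})$, and let $\mathscr K(\mathcal H)$ be the algebra of all compact operators on $\Gamma(\mathcal H)$. Then $W(u)\theta(N)\in\mathscr A(\mathcal H)$ for all $u\in\mathcal H$ and $\theta\in C_0(\mathbb N)$, and there is a unique $*$-morphism $\mathcal P:\mathscr A(\mathcal H)\to\mathscr A(\mathcal H)$ such that $$\mathcal P\big(W(u)\theta(N)\big)=W(u)\theta(N+1)\qquad\text{for all }u\in\mathcal H,\ \theta\in C_0(\mathbb N).$$ This morphism (the canonical endomorphism of $\mathscr A(\mathcal H)$) is surjective and its kernel is $\mathscr K(\mathcal H)$; in particular $\mathscr K(\mathcal H)\subset\mathscr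 A(\mathcal H)$. Hence $\mathcal P$ induces a canonical isometric $*$-isomorphism $$\mathscr A(\mathcal H)/\mathscr K(\mathcal H)\;\cong\;\mathscr A(\mathcal H).$$ -/

import Mathlib

namespace BoseFock

noncomputable section

open scoped ComplexOrder ComplexConjugate InnerProductSpace

section Kernel

variable {H : Type*} [NormedAddCommGroup H] [InnerProductSpace ℂ H]

/-- `⟨u₁ ⋯ uₙ | v₁ ⋯ vₙ⟩ = ∑_σ ∏ i, ⟨u_i | v_{σ i}⟩`. -/
def symKernel (H : Type*) [NormedAddCommGroup H] [InnerProductSpace ℂ H] (n : ℕ) :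
    Matrix (Fin n → H) (Fin n → H) ℂ :=
  Matrix.of fun u v => ∑ σ : Equiv.Perm (Fin n), ∏ i, ⟪u i, v (σ i)⟫_ℂ

theorem posSemidef_gramDiff (A : H →L[ℂ] H) (hA : ‖A‖ ≤ 1) :
    (Matrix.of fun u v : H => ⟪u, v⟫_ℂ - ⟪A u, A v⟫_ℂ).PosSemidef := by
  refine ⟨?_, fun c => ?_⟩
  · ext u v
    simp
  · have key : (c.sum fun i xi => c.sum fun j xj =>
        star xi * (Matrix.of fun u v : H => ⟪u, v⟫_ℂ - ⟪A u, A v⟫_ℂ) i j * xj)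
        = ⟪c.sum fun u a => a • u, c.sum fun u a => a • u⟫_ℂ
          - ⟪A (c.sum fun u a => a • u), A (c.sum fun u a => a • u)⟫_ℂ := by
      simp only [Finsupp.sum, map_sum, sum_inner, inner_sum, map_smul, inner_smul_left,
        inner_smul_right, Finset.mul_sum, ← Finset.sum_sub_distrib]
      rw [Finset.sum_comm]
      refine Finset.sum_congr rfl fun i _ => Finset.sum_congr rfl fun j _ => ?_
      simp only [Matrix.of_apply, RCLike.star_def]
      ring
    rw [key, inner_self_eq_norm_sq_to_K, inner_self_eq_norm_sq_to_K, sub_nonneg]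
    have h1 := A.le_of_opNorm_le hA (c.sum fun u a => a • u)
    rw [one_mul] at h1
    have h2 := pow_le_pow_left₀ (norm_nonneg _) h1 2
    exact_mod_cast h2

theorem posSemidef_gram : (Matrix.of fun u v : H => ⟪u, v⟫_ℂ).PosSemidef := by
  simpa using posSemidef_gramDiff (0 : H →L[ℂ] H) (by simp)

theorem posSemidef_one (X : Type*) : (Matrix.of fun _ _ : X => (1 : ℂ)).PosSemidef := by
  refine ⟨by ext; simp, fun c => ?_⟩
  have key : (c.sum fun i xi => c.sum fun j xj => star xi * (Matrix.of fun _ _ : X => (1 : ℂ)) i j * xj)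
      = star (c.sum fun _ a => a) * (c.sum fun _ a => a) := by
    simp [Finsupp.sum, Finset.sum_mul_sum]
  rw [key]
  exact star_mul_self_nonneg _

theorem posSemidef_prodDiff (A : H →L[ℂ] H) (hA : ‖A‖ ≤ 1) (n : ℕ) (s : Finset (Fin n)) :
    (Matrix.of fun u v : Fin n → H => ∏ i ∈ s, ⟪A (u i), A (v i)⟫_ℂ).PosSemidef ∧
    (Matrix.of fun u v : Fin n → H => ∏ i ∈ s, ⟪u i, v i⟫_ℂ
      - ∏ i ∈ s, ⟪A (u i), A (v i)⟫_ℂ).PosSemidef := by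
  induction s using Finset.induction_on with
  | empty =>
    refine ⟨by simpa using posSemidef_one (Fin n → H), ?_⟩
    have h0 : (Matrix.of fun u v : Fin n → H => ∏ i ∈ (∅ : Finset (Fin n)), ⟪u i, v i⟫_ℂ
        - ∏ i ∈ (∅ : Finset (Fin n)), ⟪A (u i), A (v i)⟫_ℂ) = 0 := by
      ext u v
      simp
    rw [h0]
    exact Matrix.PosSemidef.zero
  | insert k s hk ih =>
    have hA1 : (Matrix.of fun u v : Fin n → H => ⟪A (u k), A (v k)⟫_ℂ).PosSemidef :=
      (posSemidef_gram (H := H)).submatrix fun u : Fin n → H => A (u k)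
    have h1 : (Matrix.of fun u v : Fin n → H => ⟪u k, v k⟫_ℂ).PosSemidef :=
      (posSemidef_gram (H := H)).submatrix fun u : Fin n → H => u k
    have hd : (Matrix.of fun u v : Fin n → H =>
        ⟪u k, v k⟫_ℂ - ⟪A (u k), A (v k)⟫_ℂ).PosSemidef :=
      (posSemidef_gramDiff A hA).submatrix fun u : Fin n → H => u k
    refine ⟨?_, ?_⟩
    · have e : (Matrix.of fun u v : Fin n → H => ∏ i ∈ insert k s, ⟪A (u i), A (v i)⟫_ℂ)
          = Matrix.hadamard (Matrix.of fun u v : Fin n → H => ⟪A (u k), A (v k)⟫_ℂ)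
            (Matrix.of fun u v : Fin n → H => ∏ i ∈ s, ⟪A (u i), A (v i)⟫_ℂ) := by
        ext u v
        simp [Finset.prod_insert hk]
      rw [e]
      exact hA1.hadamard ih.1
    · have e : (Matrix.of fun u v : Fin n → H => ∏ i ∈ insert k s, ⟪u i, v i⟫_ℂ
            - ∏ i ∈ insert k s, ⟪A (u i), A (v i)⟫_ℂ)
          = Matrix.hadamard (Matrix.of fun u v : Fin n → H => ⟪u k, v k⟫_ℂ)
              (Matrix.of fun u v : Fin n → H => ∏ i ∈ s, ⟪u i, v i⟫_ℂ
                - ∏ i ∈ s, ⟪A (u i), A (v i)⟫_ℂ)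
            + Matrix.hadamard (Matrix.of fun u v : Fin n → H =>
                ⟪u k, v k⟫_ℂ - ⟪A (u k), A (v k)⟫_ℂ)
              (Matrix.of fun u v : Fin n → H => ∏ i ∈ s, ⟪A (u i), A (v i)⟫_ℂ) := by
        ext u v
        simp only [Matrix.of_apply, Finset.prod_insert hk, Matrix.add_apply, Matrix.hadamard_apply]
        ring
      rw [e]
      exact Matrix.PosSemidef.add (h1.hadamard ih.2) (hd.hadamard ih.1)

theorem posSemidef_symm {X S : Type*} [Fintype S] {M : Matrix X X ℂ} (hM : M.PosSemidef)
    (g : S → X → X) :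
    (Matrix.of fun x y => ∑ σ : S, ∑ τ : S, M (g σ x) (g τ y)).PosSemidef := by
  refine ⟨?_, fun c => ?_⟩
  · ext x y
    simp only [Matrix.conjTranspose_apply, Matrix.of_apply, star_sum]
    rw [Finset.sum_comm]
    exact Finset.sum_congr rfl fun i _ => Finset.sum_congr rfl fun j _ => hM.1.apply _ _
  · have h := hM.2 (∑ σ, c.mapDomain (g σ))
    have key : ∀ (F : X → ℂ → ℂ), (∀ x, F x 0 = 0) → (∀ x a b, F x (a + b) = F x a + F x b) →
        (∑ σ, c.mapDomain (g σ)).sum F = c.sum fun x a => ∑ σ, F (g σ x) a := by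
      intro F h0 ha
      rw [← Finsupp.sum_finsetSum_index h0 ha]
      simp only [Finsupp.sum_mapDomain_index h0 ha]
      simp only [Finsupp.sum]
      rw [Finset.sum_comm]
    have e1 : ∀ x (a : ℂ), ((∑ τ, c.mapDomain (g τ)).sum fun j xj => star a * M x j * xj)
        = c.sum fun y b => ∑ τ, star a * M x (g τ y) * b :=
      fun x a => key _ (by simp) (by intros; ring)
    simp only [e1] at h
    rw [key _ (by simp) (by
      intro x a b
      simp only [star_add, add_mul, Finset.sum_add_distrib, Finsupp.sum_add])] at h
    convert h using 1
    refine Finset.sum_congr rfl fun x _ => ?_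
    simp only [Finsupp.sum]
    rw [Finset.sum_comm]
    refine Finset.sum_congr rfl fun y _ => ?_
    simp [Finset.mul_sum, Finset.sum_mul]

theorem symKernel_symmetrize (n : ℕ) (u v : Fin n → H) :
    ∑ σ : Equiv.Perm (Fin n), ∑ τ : Equiv.Perm (Fin n), ∏ i, ⟪u (σ i), v (τ i)⟫_ℂ
      = (n.factorial : ℂ) * symKernel H n u v := by
  have : ∀ σ : Equiv.Perm (Fin n), ∑ τ : Equiv.Perm (Fin n), ∏ i, ⟪u (σ i), v (τ i)⟫_ℂ
      = symKernel H n u v := by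
    intro σ
    rw [← Equiv.sum_comp (Equiv.mulRight σ)]
    refine Finset.sum_congr rfl fun τ _ => ?_
    exact Equiv.prod_comp σ fun i => ⟪u i, v (τ i)⟫_ℂ
  simp [this, Fintype.card_perm]

theorem posSemidef_symKernelDiff (A : H →L[ℂ] H) (hA : ‖A‖ ≤ 1) (n : ℕ) :
    (Matrix.of fun u v : Fin n → H => symKernel H n u v
      - symKernel H n (fun i => A (u i)) (fun i => A (v i))).PosSemidef := by
  have h := posSemidef_symm (posSemidef_prodDiff A hA n Finset.univ).2
    fun (σ : Equiv.Perm (Fin n)) (u : Fin n → H) i => u (σ i)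
  have h2 := h.smul (a := ((n.factorial : ℝ)⁻¹ : ℝ)) (by positivity)
  convert h2 using 1
  ext u v
  have hn : (n.factorial : ℂ) ≠ 0 := by exact_mod_cast n.factorial_ne_zero
  simp only [Matrix.of_apply, Finset.sum_sub_distrib, Matrix.smul_apply, Complex.real_smul]
  rw [symKernel_symmetrize n u v,
    symKernel_symmetrize n (fun i => A (u i)) (fun i => A (v i)), ← mul_sub]
  push_cast
  rw [inv_mul_cancel_left₀ hn]

theorem posSemidef_symKernel (n : ℕ) : (symKernel H n).PosSemidef := by
  have h := posSemidef_symm (posSemidef_prodDiff (0 : H →L[ℂ] H) (by simp) n Finset.univ).2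
    fun (σ : Equiv.Perm (Fin n)) (u : Fin n → H) i => u (σ i)
  have hb : (Matrix.of fun u v : Fin n → H => ∏ i, ⟪u i, v i⟫_ℂ).PosSemidef := by
    have h := posSemidef_prodDiff (0 : H →L[ℂ] H) (by simp) n Finset.univ
    convert h.1.add h.2 using 1
    ext u v
    simp
  have h2 := (posSemidef_symm hb
    fun (σ : Equiv.Perm (Fin n)) (u : Fin n → H) i => u (σ i)).smul
      (a := ((n.factorial : ℝ)⁻¹ : ℝ)) (by positivity)
  convert h2 using 1
  ext u v
  have hn : (n.factorial : ℂ) ≠ 0 := by exact_mod_cast n.factorial_ne_zero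
  simp only [Matrix.of_apply, Matrix.smul_apply, Complex.real_smul]
  rw [symKernel_symmetrize n u v]
  push_cast
  rw [inv_mul_cancel_left₀ hn]

end Kernel

section Levels

set_option linter.unusedSectionVars false

variable {H : Type*} [NormedAddCommGroup H] [InnerProductSpace ℂ H]

/-- The sesquilinear extension of `symKernel` to formal linear combinations. -/
def symForm (n : ℕ) (f g : (Fin n → H) →₀ ℂ) : ℂ :=
  f.sum fun u a => g.sum fun v b => star a * symKernel H n u v * b

theorem symForm_conj (n : ℕ) (f g : (Fin n → H) →₀ ℂ) :
    conj (symForm n g f) = symForm n f g := by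
  rw [symForm, Finsupp.sum_comm]
  simp only [map_finsuppSum, symForm]
  refine Finsupp.sum_congr fun u _ => Finsupp.sum_congr fun v _ => ?_
  rw [← (posSemidef_symKernel n).isHermitian.apply]
  simp only [RCLike.star_def, map_mul, Complex.conj_conj]
  ring

theorem symForm_add (n : ℕ) (f g h : (Fin n → H) →₀ ℂ) :
    symForm n (f + g) h = symForm n f h + symForm n g h := by
  refine Finsupp.sum_add_index' (by simp) fun u a b => ?_
  simp only [star_add, add_mul, Finsupp.sum_add]

theorem symForm_smul (n : ℕ) (f g : (Fin n → H) →₀ ℂ) (c : ℂ) :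
    symForm n (c • f) g = conj c * symForm n f g := by
  refine (Finsupp.sum_smul_index (by simp)).trans ?_
  simp [symForm, Finsupp.mul_sum, mul_assoc]

theorem symForm_gammaDiff (n : ℕ) (A : H →L[ℂ] H) (hA : ‖A‖ ≤ 1) (f : (Fin n → H) →₀ ℂ) :
    0 ≤ symForm n f f - symForm n (f.mapDomain fun u i => A (u i)) (f.mapDomain fun u i => A (u i)) := by
  have e : symForm n f f - symForm n (f.mapDomain fun u i => A (u i))
      (f.mapDomain fun u i => A (u i)) = f.sum fun u a => f.sum fun v b => star a *
      (Matrix.of fun u v : Fin n → H => symKernel H n u v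
      - symKernel H n (fun i => A (u i)) (fun i => A (v i))) u v * b := by
    have e1 : ∀ (u : Fin n → H) (a : ℂ), ((f.mapDomain fun u i => A (u i)).sum fun v b =>
        star a * symKernel H n u v * b)
        = f.sum fun v b => star a * symKernel H n u (fun i => A (v i)) * b :=
      fun u a => Finsupp.sum_mapDomain_index (by simp) (by intros; ring)
    have e2 := Finsupp.sum_mapDomain_index (f := fun (u : Fin n → H) i => A (u i)) (s := f)
      (h := fun u a => f.sum fun v b => star a * symKernel H n u (fun i => A (v i)) * b)
      (by simp) (by intro u a b; simp only [star_add, add_mul, Finsupp.sum_add])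
    rw [symForm, symForm]
    simp only [e1]
    rw [e2]
    simp only [Finsupp.sum, ← Finset.sum_sub_distrib]
    refine Finset.sum_congr rfl fun u _ => Finset.sum_congr rfl fun v _ => ?_
    simp only [Matrix.of_apply]
    ring
  rw [e]
  exact (posSemidef_symKernelDiff A hA n).2 f

variable (H)

/-- Formal linear combinations of products `u₁ ⋯ uₙ`; modulo the null vectors of the
scalar product below this is the `n`-th symmetric power of `H`. -/
def PreSymPow (n : ℕ) : Type _ := (Fin n → H) →₀ ℂ

instance (n : ℕ) : AddCommGroup (PreSymPow H n) := inferInstanceAs (AddCommGroup ((Fin n → H) →₀ ℂ))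

instance (n : ℕ) : Module ℂ (PreSymPow H n) := inferInstanceAs (Module ℂ ((Fin n → H) →₀ ℂ))

variable {H}

/-- The formal product `u₁ ⋯ uₙ`. -/
def PreSymPow.mk {n : ℕ} (u : Fin n → H) : PreSymPow H n := (Finsupp.single u 1 : (Fin n → H) →₀ ℂ)

theorem PreSymPow.induction {n : ℕ} {p : PreSymPow H n → Prop} (f : PreSymPow H n)
    (h0 : p 0) (ha : ∀ f g, p f → p g → p (f + g)) (hs : ∀ (c : ℂ) u, p (c • .mk u)) : p f := by
  refine Finsupp.induction_linear (M := ℂ) (motive := p) f h0 ha fun u c => ?_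
  have := hs c u
  have e : (c • PreSymPow.mk u : PreSymPow H n) = (Finsupp.single u c : (Fin n → H) →₀ ℂ) := by
    refine (Finsupp.smul_single c u 1).trans ?_
    simp
  rwa [e] at this

/-- The scalar product determined by
`⟨u₁ ⋯ uₙ | v₁ ⋯ vₙ⟩ = ∑_σ ∏ i, ⟨u_i | v_{σ i}⟩`. -/
instance PreSymPow.core (n : ℕ) : PreInnerProductSpace.Core ℂ (PreSymPow H n) where
  inner f g := symForm n f g
  conj_inner_symm f g := symForm_conj n f g
  re_inner_nonneg f := (Complex.le_def.1 ((posSemidef_symKernel n).2 f)).1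
  add_left f g h := symForm_add n f g h
  smul_left f g c := symForm_smul n f g c

instance (n : ℕ) : SeminormedAddCommGroup (PreSymPow H n) :=
  InnerProductSpace.Core.toSeminormedAddCommGroup (𝕜 := ℂ)

instance (n : ℕ) : InnerProductSpace ℂ (PreSymPow H n) := .ofCore _

theorem PreSymPow.inner_mk {n : ℕ} (u v : Fin n → H) :
    ⟪PreSymPow.mk u, PreSymPow.mk v⟫_ℂ = symKernel H n u v := by
  change symForm n (Finsupp.single u 1) (Finsupp.single v 1) = _
  simp [symForm]

/-- The linear map given on products by an arbitrary function. -/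
def PreSymPow.lift {n : ℕ} {E : Type*} [AddCommGroup E] [Module ℂ E] (F : (Fin n → H) → E) :
    PreSymPow H n →ₗ[ℂ] E :=
  Finsupp.linearCombination ℂ F

@[simp]
theorem PreSymPow.lift_mk {n : ℕ} {E : Type*} [AddCommGroup E] [Module ℂ E]
    (F : (Fin n → H) → E) (u : Fin n → H) : PreSymPow.lift F (.mk u) = F u :=
  (Finsupp.linearCombination_single ℂ 1 u).trans (one_smul ℂ _)

/-- Multiplication by `u`. -/
def preCreation (n : ℕ) (u : H) : PreSymPow H n →ₗ[ℂ] PreSymPow H (n + 1) :=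
  PreSymPow.lift fun v => .mk (Fin.cons u v)

/-- The derivation `v₁ ⋯ vₙ₊₁ ↦ ∑ i, ⟨u | v_i⟩ ∏_{j ≠ i} v_j`. -/
def preAnnihilation (n : ℕ) (u : H) : PreSymPow H (n + 1) →ₗ[ℂ] PreSymPow H n :=
  PreSymPow.lift fun v => ∑ i, ⟪u, v i⟫_ℂ • .mk (i.removeNth v)

theorem symKernel_cons (n : ℕ) (u : H) (v : Fin n → H) (w : Fin (n + 1) → H) :
    symKernel H (n + 1) (Fin.cons u v) w = ∑ i, ⟪u, w i⟫_ℂ * symKernel H n v (i.removeNth w) := by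
  simp only [symKernel, Matrix.of_apply, Finset.mul_sum]
  rw [← Equiv.sum_comp Equiv.Perm.decomposeFin.symm, Fintype.sum_prod_type]
  refine Finset.sum_congr rfl fun p _ => ?_
  obtain ⟨⟨q, π⟩, hπ⟩ : ∃ x, Equiv.Perm.decomposeFin.symm x = p.cycleRange * Equiv.swap 0 p :=
    ⟨_, Equiv.symm_apply_apply _ _⟩
  have hq : q = 0 := by
    have := congrArg (fun e : Equiv.Perm (Fin (n + 1)) => e 0) hπ
    simpa using this
  subst hq
  have hs : ∀ j, Equiv.swap 0 p (Fin.succ j) = p.succAbove (π j) := by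
    intro j
    have := congrArg (fun e : Equiv.Perm (Fin (n + 1)) => e j.succ) hπ
    simp only [Equiv.Perm.decomposeFin_symm_apply_succ, Equiv.swap_self, Equiv.refl_apply,
      Equiv.Perm.mul_apply] at this
    rw [← Fin.cycleRange_symm_succ, this, Equiv.symm_apply_apply]
  refine Fintype.sum_equiv (Equiv.mulLeft π) _ _ fun τ => ?_
  rw [Fin.prod_univ_succ]
  simp [hs, Fin.removeNth]

theorem inner_preCreation (n : ℕ) (u : H) (f : PreSymPow H n) (g : PreSymPow H (n + 1)) :
    ⟪preCreation n u f, g⟫_ℂ = ⟪f, preAnnihilation n u g⟫_ℂ := by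
  induction f using PreSymPow.induction with
  | h0 => simp
  | ha f f' hf hf' => simp [inner_add_left, hf, hf']
  | hs c v =>
    induction g using PreSymPow.induction with
    | h0 => simp
    | ha g g' hg hg' => rw [inner_add_right, hg, hg', map_add, inner_add_right]
    | hs d w =>
      simp only [map_smul, inner_smul_left, inner_smul_right, preCreation, preAnnihilation,
        PreSymPow.lift_mk, inner_sum, PreSymPow.inner_mk, symKernel_cons]
      simp only [Finset.mul_sum]
      exact Finset.sum_congr rfl fun i _ => by ring

theorem preAnnihilation_preCreation_zero (u v : H) (f : PreSymPow H 0) :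
    preAnnihilation 0 u (preCreation 0 v f) = ⟪u, v⟫_ℂ • f := by
  induction f using PreSymPow.induction with
  | h0 => simp
  | ha f f' hf hf' => simp only [map_add, hf, hf', smul_add]
  | hs c w =>
    simp only [map_smul, preCreation, preAnnihilation, PreSymPow.lift_mk, Fin.sum_univ_succ]
    simp [smul_comm c]

theorem preAnnihilation_preCreation_succ (n : ℕ) (u v : H) (f : PreSymPow H (n + 1)) :
    preAnnihilation (n + 1) u (preCreation (n + 1) v f)
      = ⟪u, v⟫_ℂ • f + preCreation n v (preAnnihilation n u f) := by
  induction f using PreSymPow.induction with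
  | h0 => simp
  | ha f f' hf hf' => simp only [map_add, hf, hf', smul_add]; abel
  | hs c w =>
    have h0 : Fin.removeNth 0 (Fin.cons v w : Fin (n + 2) → H) = w := by
      ext i; simp [Fin.removeNth]
    have h1 : ∀ i : Fin (n + 1), Fin.removeNth i.succ (Fin.cons v w : Fin (n + 2) → H)
        = Fin.cons v (i.removeNth w) := by
      intro i
      ext j
      refine Fin.cases ?_ (fun j => ?_) j <;> simp [Fin.removeNth]
    simp only [map_smul, map_sum, preCreation, preAnnihilation, PreSymPow.lift_mk]
    rw [Fin.sum_univ_succ]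
    simp only [h0, h1, Fin.cons_zero, Fin.cons_succ, smul_add, smul_comm c]

theorem norm_preCreation_le (n : ℕ) (u : H) :
    (∀ f : PreSymPow H n, ‖preCreation n u f‖ ≤ √(n + 1) * ‖u‖ * ‖f‖) := by
  have step : ∀ n : ℕ, (∀ f : PreSymPow H n, ‖preCreation n u f‖ ≤ √(n + 1) * ‖u‖ * ‖f‖) →
      ∀ f : PreSymPow H (n + 1), ‖preAnnihilation n u f‖ ≤ √(n + 1) * ‖u‖ * ‖f‖ := by
    intro n hn f
    have h := hn (preAnnihilation n u f)
    have h1 : ‖preAnnihilation n u f‖ ^ 2 ≤ √(n + 1) * ‖u‖ * ‖preAnnihilation n u f‖ * ‖f‖ := by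
      have e := inner_preCreation n u (preAnnihilation n u f) f
      rw [inner_self_eq_norm_sq_to_K] at e
      have := norm_inner_le_norm (𝕜 := ℂ) (preCreation n u (preAnnihilation n u f)) f
      rw [e] at this
      simp only [norm_pow, Complex.coe_algebraMap, Complex.norm_real, norm_norm] at this
      exact this.trans (by gcongr)
    rcases eq_or_lt_of_le (norm_nonneg (preAnnihilation n u f)) with h0 | h0
    · rw [← h0]; positivity
    · nlinarith
  have sqs : ∀ n (f : PreSymPow H n), ‖preCreation n u f‖ ^ 2 ≤ (n + 1) * ‖u‖ ^ 2 * ‖f‖ ^ 2 →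
      ‖preCreation n u f‖ ≤ √(n + 1) * ‖u‖ * ‖f‖ := by
    intro n f hf
    refine abs_le_of_sq_le_sq' ?_ (by positivity) |>.2
    rw [mul_pow, mul_pow, Real.sq_sqrt (by positivity)]
    exact hf
  have self : ∀ n (f : PreSymPow H n), ‖preCreation n u f‖ ^ 2
      = RCLike.re ⟪f, preAnnihilation n u (preCreation n u f)⟫_ℂ := by
    intro n f
    rw [← inner_preCreation, inner_self_eq_norm_sq]
  induction n with
  | zero =>
    intro f
    refine sqs 0 f ?_
    rw [self, preAnnihilation_preCreation_zero, inner_smul_right, inner_self_eq_norm_sq_to_K,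
      inner_self_eq_norm_sq_to_K]
    refine le_of_eq ?_
    rw [← RCLike.ofReal_pow, ← RCLike.ofReal_pow, ← RCLike.ofReal_mul, RCLike.ofReal_re]
    simp
  | succ n ih =>
    intro f
    refine sqs _ f ?_
    have h2 := step n ih f
    have h3 := pow_le_pow_left₀ (norm_nonneg _) h2 2
    rw [mul_pow, mul_pow, Real.sq_sqrt (by positivity)] at h3
    rw [self, preAnnihilation_preCreation_succ, inner_add_right, inner_smul_right,
      ← inner_conj_symm f (preCreation n u _), inner_preCreation, inner_conj_symm, map_add,
      inner_self_eq_norm_sq, inner_self_eq_norm_sq_to_K, inner_self_eq_norm_sq_to_K,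
      ← RCLike.ofReal_pow, ← RCLike.ofReal_pow, ← RCLike.ofReal_mul, RCLike.ofReal_re]
    push_cast
    nlinarith

/-- The `n`-particle space. -/
abbrev SymPow (H : Type*) [NormedAddCommGroup H] [InnerProductSpace ℂ H] (n : ℕ) : Type _ :=
  UniformSpace.Completion (PreSymPow H n)

/-- The product `u₁ ⋯ uₙ`. -/
def SymPow.mk {n : ℕ} (u : Fin n → H) : SymPow H n := ((PreSymPow.mk u : PreSymPow H n) : SymPow H n)

theorem SymPow.inner_mk {n : ℕ} (u v : Fin n → H) :
    ⟪SymPow.mk u, SymPow.mk v⟫_ℂ = ∑ σ : Equiv.Perm (Fin n), ∏ i, ⟪u i, v (σ i)⟫_ℂ := by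
  rw [SymPow.mk, SymPow.mk, UniformSpace.Completion.inner_coe, PreSymPow.inner_mk]
  rfl

/-- `u₁ ⋯ uₙ ↦ u u₁ ⋯ uₙ`. -/
def creationLevel (n : ℕ) (u : H) : SymPow H n →L[ℂ] SymPow H (n + 1) :=
  ((preCreation n u).mkContinuous _ (norm_preCreation_le n u)).completion

theorem creationLevel_mk (n : ℕ) (u : H) (v : Fin n → H) :
    creationLevel n u (.mk v) = .mk (Fin.cons u v) := by
  simp [creationLevel, SymPow.mk, preCreation]

theorem norm_creationLevel_le (n : ℕ) (u : H) : ‖creationLevel n u‖ ≤ √(n + 1) * ‖u‖ := by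
  refine ContinuousLinearMap.opNorm_le_bound _ (by positivity) fun x => ?_
  induction x using UniformSpace.Completion.induction_on with
  | hp => exact isClosed_le (by fun_prop) (by fun_prop)
  | ih f => simpa [creationLevel] using norm_preCreation_le n u f

/-- `u₁ ⋯ uₙ ↦ (A u₁) ⋯ (A uₙ)`. -/
def preGamma (n : ℕ) (A : H →L[ℂ] H) : PreSymPow H n →ₗ[ℂ] PreSymPow H n :=
  PreSymPow.lift fun v => .mk fun i => A (v i)

theorem norm_preGamma_le (n : ℕ) (A : H →L[ℂ] H) (hA : ‖A‖ ≤ 1) (f : PreSymPow H n) :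
    ‖preGamma n A f‖ ≤ 1 * ‖f‖ := by
  rw [one_mul]
  refine abs_le_of_sq_le_sq' ?_ (by positivity) |>.2
  rw [← inner_self_eq_norm_sq (𝕜 := ℂ), ← inner_self_eq_norm_sq (𝕜 := ℂ)]
  have hf : preGamma n A f
      = (Finsupp.mapDomain (fun u i => A (u i)) f : (Fin n → H) →₀ ℂ) :=
    Finsupp.sum_congr fun u _ => (Finsupp.smul_single _ _ _).trans
      (congrArg (Finsupp.single _) (mul_one _))
  have h := (Complex.le_def.1 (symForm_gammaDiff n A hA f)).1
  rw [hf]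
  exact sub_nonneg.1 h

/-- `u₁ ⋯ uₙ ↦ (A u₁) ⋯ (A uₙ)`, for a contraction `A`. -/
def gammaLevel (n : ℕ) (A : H →L[ℂ] H) (hA : ‖A‖ ≤ 1) : SymPow H n →L[ℂ] SymPow H n :=
  ((preGamma n A).mkContinuous 1 (norm_preGamma_le n A hA)).completion

theorem gammaLevel_mk (n : ℕ) (A : H →L[ℂ] H) (hA : ‖A‖ ≤ 1) (v : Fin n → H) :
    gammaLevel n A hA (.mk v) = .mk fun i => A (v i) := by
  simp [gammaLevel, SymPow.mk, preGamma]

theorem norm_gammaLevel_le (n : ℕ) (A : H →L[ℂ] H) (hA : ‖A‖ ≤ 1) : ‖gammaLevel n A hA‖ ≤ 1 := by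
  refine ContinuousLinearMap.opNorm_le_bound _ (by positivity) fun x => ?_
  induction x using UniformSpace.Completion.induction_on with
  | hp => exact isClosed_le (by fun_prop) (by fun_prop)
  | ih f => simpa [gammaLevel] using norm_preGamma_le n A hA f

end Levels

section Fock

open Filter Topology

variable (H : Type*) [NormedAddCommGroup H] [InnerProductSpace ℂ H]

/-- The bosonic Fock space `Γ(H)`: the Hilbert space direct sum of the `n`-particle spaces. -/
abbrev Fock : Type _ := lp (fun n => SymPow H n) 2

/-- `Γ_fin(H)`: the vectors with finitely many particles. -/
def finiteParticle : Submodule ℂ (Fock H) where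
  carrier := {f | ∃ m, ∀ n, m ≤ n → f n = 0}
  zero_mem' := ⟨0, fun _ _ => rfl⟩
  add_mem' := by
    rintro f g ⟨m, hm⟩ ⟨k, hk⟩
    refine ⟨max m k, fun n hn => ?_⟩
    simp [hm n (le_of_max_le_left hn), hk n (le_of_max_le_right hn)]
  smul_mem' := by
    rintro c f ⟨m, hm⟩
    exact ⟨m, fun n hn => by simp [hm n hn]⟩

variable {H}

theorem hasSum_norm_sq (f : Fock H) : HasSum (fun n => ‖f n‖ ^ 2) (‖f‖ ^ 2) := by
  have := lp.hasSum_norm (p := 2) (by norm_num) f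
  simpa using this

theorem memℓp_of_finite (f : ∀ n, SymPow H n) (h : ∃ m, ∀ n, m ≤ n → f n = 0) :
    Memℓp f 2 := by
  obtain ⟨m, hm⟩ := h
  refine memℓp_gen (summable_of_ne_finset_zero (s := Finset.range m) fun n hn => ?_)
  rw [hm n (by simpa using hn)]
  simp

/-- The vector of `Γ_fin(H)` with the given components. -/
def finiteParticle.mk (f : ∀ n, SymPow H n) (h : ∃ m, ∀ n, m ≤ n → f n = 0) : finiteParticle H :=
  ⟨⟨f, memℓp_of_finite f h⟩, h⟩

/-- The components of `a*(u) f`. -/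
def creationSeq (u : H) (f : ∀ n, SymPow H n) : ∀ n, SymPow H n
  | 0 => 0
  | n + 1 => creationLevel n u (f n)

/-- The creation operator `a*(u)` on `Γ_fin(H)`: multiplication by `u`. -/
def creation (u : H) : finiteParticle H →ₗ[ℂ] finiteParticle H where
  toFun f := finiteParticle.mk (creationSeq u f.1) <| by
    obtain ⟨m, hm⟩ := f.2
    refine ⟨m + 1, fun n hn => ?_⟩
    obtain ⟨k, rfl⟩ := Nat.exists_eq_add_of_le' hn
    change creationLevel (k + m) u (f.1 (k + m)) = 0
    rw [hm _ (by omega), map_zero]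
  map_add' f g := by
    refine Subtype.ext (lp.ext (funext fun n => ?_))
    cases n with
    | zero => exact (add_zero _).symm
    | succ n => exact map_add (creationLevel n u) (f.1 n) (g.1 n)
  map_smul' c f := by
    refine Subtype.ext (lp.ext (funext fun n => ?_))
    cases n with
    | zero => exact (smul_zero (A := SymPow H 0) c).symm
    | succ n => exact map_smul (creationLevel n u) c (f.1 n)

/-- The annihilation operator `a(u)` on `Γ_fin(H)`: the adjoint of `a*(u)`. -/
def annihilation (u : H) : finiteParticle H →ₗ[ℂ] finiteParticle H where
  toFun f := finiteParticle.mk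
      (fun n => ContinuousLinearMap.adjoint (creationLevel n u) (f.1 (n + 1))) <| by
    obtain ⟨m, hm⟩ := f.2
    refine ⟨m, fun n hn => ?_⟩
    rw [hm _ (by omega), map_zero]
  map_add' f g := Subtype.ext (lp.ext (funext fun n =>
    map_add (ContinuousLinearMap.adjoint (creationLevel n u)) (f.1 (n + 1)) (g.1 (n + 1))))
  map_smul' c f := Subtype.ext (lp.ext (funext fun n =>
    map_smul (ContinuousLinearMap.adjoint (creationLevel n u)) c (f.1 (n + 1))))

theorem inner_creation (u : H) (f g : finiteParticle H) :
    ⟪(creation u f : Fock H), (g : Fock H)⟫_ℂ = ⟪(f : Fock H), (annihilation u g : Fock H)⟫_ℂ := by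
  rw [lp.inner_eq_tsum, (lp.summable_inner (𝕜 := ℂ) (creation u f).1 g.1).tsum_eq_zero_add,
    lp.inner_eq_tsum]
  have h0 : ⟪(creation u f).1 0, g.1 0⟫_ℂ = 0 := inner_zero_left _
  rw [h0, zero_add]
  refine tsum_congr fun n => ?_
  exact (ContinuousLinearMap.adjoint_inner_right (creationLevel n u) (f.1 n) (g.1 (n + 1))).symm

/-- The field operator `φ(u) = a(u) + a*(u)` on `Γ_fin(H)`. -/
def field (u : H) : finiteParticle H →ₗ[ℂ] finiteParticle H := annihilation u + creation u

theorem inner_field (u : H) (f g : finiteParticle H) :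
    ⟪(field u f : Fock H), (g : Fock H)⟫_ℂ = ⟪(f : Fock H), (field u g : Fock H)⟫_ℂ := by
  have h : ⟪(annihilation u f : Fock H), (g : Fock H)⟫_ℂ
      = ⟪(f : Fock H), (creation u g : Fock H)⟫_ℂ := by
    rw [← inner_conj_symm, ← inner_creation, inner_conj_symm]
  simp only [field, LinearMap.add_apply, Submodule.coe_add, inner_add_left, inner_add_right, inner_creation, h]
  ring

theorem field_degree (u : H) (f : finiteParticle H) (m : ℕ) (hm : ∀ n, m ≤ n → f.1 n = 0) :
    ∀ n, m + 1 ≤ n → (field u f).1 n = 0 := by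
  intro n hn
  obtain ⟨k, rfl⟩ := Nat.exists_eq_add_of_le' hn
  change ContinuousLinearMap.adjoint (creationLevel (k + (m + 1)) u) (f.1 (k + (m + 1) + 1))
    + creationLevel (k + m) u (f.1 (k + m)) = 0
  rw [hm _ (by omega), hm _ (by omega), map_zero, map_zero, add_zero]

theorem norm_creation_le (u : H) (f : finiteParticle H) (m : ℕ) (hm : ∀ n, m ≤ n → f.1 n = 0) :
    ‖creation u f‖ ≤ √m * ‖u‖ * ‖f‖ := by
  refine abs_le_of_sq_le_sq' ?_ (by positivity) |>.2
  rw [mul_pow, mul_pow, Real.sq_sqrt (by positivity)]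
  have h1 := hasSum_norm_sq (creation u f).1
  have h2 := (hasSum_norm_sq f.1).mul_left ((m : ℝ) * ‖u‖ ^ 2)
  change ‖(creation u f).1‖ ^ 2 ≤ m * ‖u‖ ^ 2 * ‖f.1‖ ^ 2
  rw [← h1.tsum_eq, h1.summable.tsum_eq_zero_add]
  have h0 : ‖(creation u f).1 0‖ = 0 := norm_zero
  rw [h0, zero_pow two_ne_zero, zero_add, ← h2.tsum_eq]
  have h3 : Summable fun n => ‖(creation u f).1 (n + 1)‖ ^ 2 :=
    (summable_nat_add_iff (f := fun n => ‖(creation u f).1 n‖ ^ 2) 1).2 h1.summable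
  refine h3.tsum_le_tsum (fun n => ?_) h2.summable
  change ‖creationLevel n u (f.1 n)‖ ^ 2 ≤ _
  rcases lt_or_ge n m with hn | hn
  · have h3 := (creationLevel n u).le_of_opNorm_le (norm_creationLevel_le n u) (f.1 n)
    have h4 := pow_le_pow_left₀ (norm_nonneg _) h3 2
    rw [mul_pow, mul_pow, Real.sq_sqrt (by positivity)] at h4
    refine h4.trans ?_
    have : (n : ℝ) + 1 ≤ m := by exact_mod_cast hn
    gcongr
  · rw [hm n hn]
    simp

theorem norm_annihilation_le (u : H) (f : finiteParticle H) (m : ℕ)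
    (hm : ∀ n, m ≤ n → f.1 n = 0) : ‖annihilation u f‖ ≤ √m * ‖u‖ * ‖f‖ := by
  have hd : ∀ n, m ≤ n → (annihilation u f).1 n = 0 := by
    intro n hn
    change ContinuousLinearMap.adjoint (creationLevel n u) (f.1 (n + 1)) = 0
    rw [hm _ (by omega), map_zero]
  have h1 := norm_creation_le u (annihilation u f) m hd
  have h2 : ‖annihilation u f‖ ^ 2 ≤ √m * ‖u‖ * ‖annihilation u f‖ * ‖f‖ := by
    have e := inner_creation u (annihilation u f) f
    rw [inner_self_eq_norm_sq_to_K] at e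
    have := norm_inner_le_norm (𝕜 := ℂ) (creation u (annihilation u f) : Fock H) (f : Fock H)
    rw [e, norm_pow, RCLike.norm_ofReal, abs_norm] at this
    exact this.trans (mul_le_mul_of_nonneg_right h1 (norm_nonneg _))
  rcases eq_or_lt_of_le (norm_nonneg (annihilation u f)) with h0 | h0
  · rw [← h0]; positivity
  · nlinarith

theorem norm_field_le (u : H) (f : finiteParticle H) (m : ℕ) (hm : ∀ n, m ≤ n → f.1 n = 0) :
    ‖field u f‖ ≤ 2 * √m * ‖u‖ * ‖f‖ := by
  have h := norm_add_le (annihilation u f) (creation u f)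
  have h1 := norm_creation_le u f m hm
  have h2 := norm_annihilation_le u f m hm
  change ‖annihilation u f + creation u f‖ ≤ _
  linarith

/-- The `k`-th term `(iφ(u))ᵏ f / k!` of the exponential series of `iφ(u)`. -/
def expTerm (u : H) (k : ℕ) : finiteParticle H →ₗ[ℂ] finiteParticle H :=
  ((k.factorial : ℂ)⁻¹) • (Complex.I • field u) ^ k

theorem expTerm_succ (u : H) (k : ℕ) (f : finiteParticle H) :
    expTerm u (k + 1) f = (((k + 1 : ℕ) : ℂ)⁻¹ * Complex.I) • field u (expTerm u k f) := by
  simp only [expTerm, LinearMap.smul_apply, pow_succ', Module.End.mul_apply, map_smul,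
    Nat.factorial_succ, smul_smul]
  congr 1
  push_cast
  rw [mul_inv]
  ring

theorem expTerm_degree (u : H) (f : finiteParticle H) (m : ℕ) (hm : ∀ n, m ≤ n → f.1 n = 0)
    (k : ℕ) : ∀ n, m + k ≤ n → (expTerm u k f).1 n = 0 := by
  induction k with
  | zero => simpa [expTerm] using hm
  | succ k ih =>
    intro n hn
    rw [expTerm_succ]
    have := field_degree u _ _ ih n hn
    simp [this]

theorem summable_norm_expTerm (u : H) (f : finiteParticle H) :
    Summable fun k => ‖expTerm u k f‖ := by
  obtain ⟨m, hm⟩ := f.2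
  have hb : ∀ k, ‖expTerm u (k + 1) f‖
      ≤ 2 * √((m + k : ℕ)) * ‖u‖ / ((k + 1 : ℕ) : ℝ) * ‖expTerm u k f‖ := by
    intro k
    rw [expTerm_succ, norm_smul, norm_mul, norm_inv, Complex.norm_natCast, Complex.norm_I, mul_one]
    have := norm_field_le u _ _ (expTerm_degree u f m hm k)
    rw [div_mul_eq_mul_div, inv_mul_eq_div]
    gcongr
  have hlim : Tendsto (fun k : ℕ => 2 * √((m + k : ℕ)) * ‖u‖ / ((k + 1 : ℕ) : ℝ)) atTop (𝓝 0) := by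
    have hu : ∀ k : ℕ, 2 * √((m + k : ℕ)) * ‖u‖ / ((k + 1 : ℕ) : ℝ)
        ≤ 2 * √(m + 1) * ‖u‖ * (√((k + 1 : ℕ)))⁻¹ := by
      intro k
      have h1 : √((m + k : ℕ)) ≤ √(m + 1) * √((k + 1 : ℕ)) := by
        rw [← Real.sqrt_mul (by positivity)]
        refine Real.sqrt_le_sqrt ?_
        push_cast
        nlinarith [(Nat.cast_nonneg m : (0 : ℝ) ≤ m), (Nat.cast_nonneg k : (0 : ℝ) ≤ k)]
      have h2 : ((k + 1 : ℕ) : ℝ) = √((k + 1 : ℕ)) * √((k + 1 : ℕ)) :=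
        (Real.mul_self_sqrt (by positivity)).symm
      have h3 : 0 < √((k + 1 : ℕ) : ℝ) := Real.sqrt_pos.2 (by positivity)
      rw [div_le_iff₀ (by positivity)]
      calc 2 * √((m + k : ℕ)) * ‖u‖ ≤ 2 * (√(m + 1) * √((k + 1 : ℕ))) * ‖u‖ := by gcongr
        _ = 2 * √(m + 1) * ‖u‖ * (√((k + 1 : ℕ)))⁻¹ * (√((k + 1 : ℕ)) * √((k + 1 : ℕ))) := by
            field_simp
        _ = _ := by rw [← h2]
    refine squeeze_zero (fun k => by positivity) hu ?_
    rw [← mul_zero (2 * √(m + 1) * ‖u‖)]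
    refine Tendsto.const_mul _ (tendsto_inv_atTop_zero.comp ?_)
    exact Real.tendsto_sqrt_atTop.comp
      (tendsto_natCast_atTop_atTop.comp (tendsto_add_atTop_nat 1))
  refine summable_of_ratio_norm_eventually_le (r := 1 / 2) (by norm_num) ?_
  filter_upwards [hlim.eventually (ge_mem_nhds (by norm_num : (0 : ℝ) < 1 / 2))] with k hk
  rw [norm_norm, norm_norm]
  exact (hb k).trans (by gcongr)

theorem summable_expTerm (u : H) (f : finiteParticle H) :
    Summable fun k => (expTerm u k f : Fock H) :=
  Summable.of_norm (summable_norm_expTerm u f)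

/-- `e^{iφ(u)}` on `Γ_fin(H)`, as the sum of its exponential series. -/
def weylFinite (u : H) : finiteParticle H →ₗ[ℂ] Fock H where
  toFun f := ∑' k, (expTerm u k f : Fock H)
  map_add' f g := by
    simp only [map_add, Submodule.coe_add]
    exact (summable_expTerm u f).tsum_add (summable_expTerm u g)
  map_smul' c f := by
    simp only [map_smul, Submodule.coe_smul]
    exact (summable_expTerm u f).tsum_const_smul c

theorem inner_expTerm (u : H) (f : finiteParticle H) (j k : ℕ) :
    ⟪(expTerm u j f : Fock H), (expTerm u k f : Fock H)⟫_ℂ = (-Complex.I) ^ j * Complex.I ^ k *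
      ((j.factorial : ℂ)⁻¹ * (k.factorial : ℂ)⁻¹) * ⟪(f : Fock H), ((field u ^ (j + k)) f : finiteParticle H)⟫_ℂ := by
  have h : ∀ (j : ℕ) (g h : finiteParticle H),
      ⟪(((field u ^ j) g : finiteParticle H) : Fock H), (h : Fock H)⟫_ℂ
        = ⟪(g : Fock H), ((field u ^ j) h : finiteParticle H)⟫_ℂ := by
    intro j
    induction j with
    | zero => intro g h; simp
    | succ j ih =>
      intro g h
      rw [pow_succ', Module.End.mul_apply, inner_field, ih, ← Module.End.mul_apply, ← pow_succ, pow_succ']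
  simp only [expTerm, smul_pow, LinearMap.smul_apply, Submodule.coe_smul, inner_smul_left, inner_smul_right, h,
    ← Module.End.mul_apply, ← pow_add, map_inv₀, map_pow, Complex.conj_I, Complex.conj_natCast]
  ring

theorem tsum_prod_eq_tsum_antidiagonal {F : ℕ × ℕ → ℂ} (hF : Summable F) :
    ∑' p, F p = ∑' n, ∑' c : Finset.HasAntidiagonal.antidiagonal n, F c.1 := by
  rw [← Finset.HasAntidiagonal.sigmaAntidiagonalEquivProd.tsum_eq]
  exact Summable.tsum_sigma' (fun _ => (hasSum_fintype _).summable)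
    (Finset.HasAntidiagonal.sigmaAntidiagonalEquivProd.summable_iff.2 hF)

theorem norm_weylFinite (u : H) (f : finiteParticle H) : ‖weylFinite u f‖ = ‖(f : Fock H)‖ := by
  have hs := summable_expTerm u f
  have key : ⟪weylFinite u f, weylFinite u f⟫_ℂ = ⟪(f : Fock H), (f : Fock H)⟫_ℂ := by
    have h1 : ∀ y : Fock H, ⟪y, weylFinite u f⟫_ℂ = ∑' k, ⟪y, (expTerm u k f : Fock H)⟫_ℂ :=
      fun y => (innerSL ℂ y).map_tsum hs
    have h2 : ∀ y : Fock H, ⟪weylFinite u f, y⟫_ℂ = ∑' k, ⟪(expTerm u k f : Fock H), y⟫_ℂ :=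
      fun y => ((innerSLFlip ℂ y)).map_tsum hs
    have hp : Summable fun p : ℕ × ℕ =>
        ⟪(expTerm u p.1 f : Fock H), (expTerm u p.2 f : Fock H)⟫_ℂ := by
      refine Summable.of_norm_bounded ((summable_norm_expTerm u f).mul_of_nonneg
        (summable_norm_expTerm u f) (fun _ => norm_nonneg _) fun _ => norm_nonneg _) fun p => ?_
      exact norm_inner_le_norm _ _
    rw [h2]
    simp only [h1]
    rw [← hp.tsum_prod, tsum_prod_eq_tsum_antidiagonal hp]
    have h3 : ∀ n : ℕ, (∑' c : Finset.HasAntidiagonal.antidiagonal n,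
        ⟪(expTerm u c.1.1 f : Fock H), (expTerm u c.1.2 f : Fock H)⟫_ℂ)
        = if n = 0 then ⟪(f : Fock H), (f : Fock H)⟫_ℂ else 0 := by
      intro n
      rw [Finset.tsum_subtype (Finset.HasAntidiagonal.antidiagonal n)
        fun c => ⟪(expTerm u c.1 f : Fock H), (expTerm u c.2 f : Fock H)⟫_ℂ]
      have h4 : ∀ c ∈ Finset.HasAntidiagonal.antidiagonal n,
          ⟪(expTerm u c.1 f : Fock H), (expTerm u c.2 f : Fock H)⟫_ℂ
          = ((n.factorial : ℂ)⁻¹ * ⟪(f : Fock H), ((field u ^ n) f : finiteParticle H)⟫_ℂ) *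
            (n.choose c.1 • ((-Complex.I) ^ c.1 * Complex.I ^ c.2)) := by
        intro c hc
        rw [Finset.HasAntidiagonal.mem_antidiagonal] at hc
        subst hc
        refine (inner_expTerm u f c.1 c.2).trans ?_
        have h5 : ((c.1 + c.2).choose c.1 : ℂ) * (c.1.factorial * c.2.factorial)
            = (c.1 + c.2).factorial := by
          rw [← mul_assoc]
          rw [Nat.choose_symm_add]
          exact_mod_cast Nat.add_choose_mul_factorial_mul_factorial c.1 c.2
        have h6 : ((c.1 + c.2).factorial : ℂ) ≠ 0 := by exact_mod_cast Nat.factorial_ne_zero _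
        have h7 : (c.1.factorial : ℂ) ≠ 0 := by exact_mod_cast Nat.factorial_ne_zero _
        have h8 : (c.2.factorial : ℂ) ≠ 0 := by exact_mod_cast Nat.factorial_ne_zero _
        have h9 : (c.1.factorial : ℂ)⁻¹ * (c.2.factorial : ℂ)⁻¹
            = ((c.1 + c.2).factorial : ℂ)⁻¹ * (c.1 + c.2).choose c.1 := by
          rw [← h5] at h6 ⊢
          field_simp [left_ne_zero_of_mul h6]
        rw [h9, nsmul_eq_mul]
        ring
      rw [Finset.sum_congr rfl h4, ← Finset.mul_sum,
        ← (Commute.all (-Complex.I) Complex.I).add_pow', neg_add_cancel]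
      rcases eq_or_ne n 0 with rfl | hn
      · simp
      · simp [hn]
    refine (tsum_congr h3).trans ?_
    simp
  rw [inner_self_eq_norm_sq_to_K, inner_self_eq_norm_sq_to_K] at key
  have key' : ‖weylFinite u f‖ ^ 2 = ‖(f : Fock H)‖ ^ 2 := by exact_mod_cast key
  exact (sq_eq_sq₀ (norm_nonneg _) (norm_nonneg _)).1 key'

theorem denseRange_finiteParticle : DenseRange (finiteParticle H).subtype := by
  intro f
  refine mem_closure_of_tendsto (lp.hasSum_single (p := 2) (by simp) f) (Eventually.of_forall
    fun s => ?_)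
  refine ⟨⟨∑ i ∈ s, lp.single 2 i (f i), Submodule.sum_mem _ fun i _ => ?_⟩, rfl⟩
  exact ⟨i + 1, fun n hn => lp.single_apply_ne _ _ _ (by omega)⟩

/-- The Weyl operator `W(u) = e^{iφ(u)}`: the continuous extension to `Γ(H)` of the sum of the
exponential series on `Γ_fin(H)`, all of whose vectors are entire analytic for `φ(u)`. -/
def weyl (u : H) : Fock H →L[ℂ] Fock H := (weylFinite u).extendOfNorm (finiteParticle H).subtype

theorem hasSum_weyl (u : H) (f : finiteParticle H) :
    HasSum (fun k : ℕ => ((((k.factorial : ℂ)⁻¹) • (Complex.I • field u) ^ k) f : Fock H))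
      (weyl u f) := by
  have : weyl u f = weylFinite u f :=
    LinearMap.extendOfNorm_eq denseRange_finiteParticle
      ⟨1, fun f => by rw [one_mul]; exact (norm_weylFinite u f).le⟩ f
  rw [this]
  exact (summable_expTerm u f).hasSum

theorem norm_weyl (u : H) (f : Fock H) : ‖weyl u f‖ = ‖f‖ := by
  refine denseRange_finiteParticle.induction_on f (isClosed_eq (by fun_prop) (by fun_prop))
    fun g => ?_
  have : weyl u g = weylFinite u g :=
    LinearMap.extendOfNorm_eq denseRange_finiteParticle
      ⟨1, fun f => by rw [one_mul]; exact (norm_weylFinite u f).le⟩ g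
  exact (congrArg norm this).trans (norm_weylFinite u g)

end Fock

section Algebras

open scoped BoundedContinuousFunction ZeroAtInfty

variable {H : Type*} [NormedAddCommGroup H] [InnerProductSpace ℂ H]

/-- `Γ(A)` for a contraction `A`: the bounded operator with `Γ(A) (u₁ ⋯ uₙ) = (A u₁) ⋯ (A uₙ)`. -/
def Gamma (A : H →L[ℂ] H) (hA : ‖A‖ ≤ 1) : Fock H →L[ℂ] Fock H :=
  lp.mapCLM 2 (fun n => gammaLevel n A hA) zero_le_one fun n => norm_gammaLevel_le n A hA

/-- `θ(N) = ∑ n, θ(n) 1ⁿ`, where `N` is the particle number operator, which is the multiplication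
by `n` on the `n`-particle space, and `1ⁿ` is the projection onto that space. -/
def numberFun (θ : ℕ →ᵇ ℂ) : Fock H →L[ℂ] Fock H :=
  lp.mapCLM 2 (fun n => θ n • ContinuousLinearMap.id ℂ (SymPow H n)) (norm_nonneg θ) fun n =>
    (norm_smul_le _ _).trans <|
      (mul_le_mul (θ.norm_coe_le_norm n) ContinuousLinearMap.norm_id_le
        (norm_nonneg _) (norm_nonneg _)).trans (mul_one _).le

/-- The function `n ↦ θ(n + 1)`. -/
def shift (θ : ℕ →ᵇ ℂ) : ℕ →ᵇ ℂ := θ.compContinuous ⟨fun n => n + 1, continuous_of_discreteTopology⟩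

theorem numberFun_apply (θ : ℕ →ᵇ ℂ) (f : Fock H) (n : ℕ) : numberFun θ f n = θ n • f n := rfl

/-- The `C*`-algebra generated by a set of operators. -/
def cstar {E : Type*} [NormedAddCommGroup E] [InnerProductSpace ℂ E] [CompleteSpace E]
    (S : Set (E →L[ℂ] E)) : NonUnitalStarSubalgebra ℂ (E →L[ℂ] E) :=
  (NonUnitalStarAlgebra.adjoin ℂ S).topologicalClosure

variable [CompleteSpace H]

/-- `F(O)`, the `C*`-algebra generated by the operators `W(u) Γ(A)` with `u ∈ H`, `A ∈ O` and
`‖A‖ < 1`. -/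
def fieldAlgebra (O : NonUnitalStarSubalgebra ℂ (H →L[ℂ] H)) :
    NonUnitalStarSubalgebra ℂ (Fock H →L[ℂ] Fock H) :=
  cstar {T | ∃ (u : H) (A : H →L[ℂ] H) (hA : ‖A‖ < 1), A ∈ O ∧ T = weyl u * Gamma A hA.le}

variable (H) in
/-- The algebra `ℂ 1` of scalar operators on `H`. -/
def scalars : NonUnitalStarSubalgebra ℂ (H →L[ℂ] H) :=
  (⊥ : StarSubalgebra ℂ (H →L[ℂ] H)).toNonUnitalStarSubalgebra

theorem mem_scalars {A : H →L[ℂ] H} : A ∈ scalars H ↔ ∃ z : ℂ, A = z • 1 := by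
  change A ∈ (⊥ : StarSubalgebra ℂ (H →L[ℂ] H)) ↔ _
  rw [StarSubalgebra.mem_bot, Set.mem_range]
  simp only [Algebra.algebraMap_eq_smul_one, eq_comm]

variable (H) in
/-- `A(H) = F(ℂ 1)`. -/
abbrev scalarFieldAlgebra : NonUnitalStarSubalgebra ℂ (Fock H →L[ℂ] Fock H) :=
  fieldAlgebra (scalars H)

theorem isCompactOperator_star {E : Type*} [NormedAddCommGroup E] [InnerProductSpace ℂ E]
    [CompleteSpace E] {T : E →L[ℂ] E} (hT : IsCompactOperator T) :
    IsCompactOperator (star T : E →L[ℂ] E) := by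
  rw [ContinuousLinearMap.star_eq_adjoint]
  have hT' : IsCompactOperator (T ∘L ContinuousLinearMap.adjoint T) := hT.comp_clm _
  have h1 : TotallyBounded ((T ∘L ContinuousLinearMap.adjoint T) '' Metric.closedBall 0 1) :=
    (hT'.isCompact_closure_image_closedBall 1).totallyBounded.subset subset_closure
  have h2 : TotallyBounded (ContinuousLinearMap.adjoint T '' Metric.closedBall 0 1) := by
    refine Metric.totallyBounded_iff.2 fun ε hε => ?_
    obtain ⟨s, hs, hsfin, hcov⟩ := Set.exists_subset_image_finite_and.1
      (Metric.finite_approx_of_totallyBounded h1 (ε ^ 2 / 2) (by positivity))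
    refine ⟨ContinuousLinearMap.adjoint T '' s, hsfin.image _, ?_⟩
    rintro _ ⟨x, hx, rfl⟩
    obtain ⟨_, ⟨y, hy, rfl⟩, hxy⟩ := Set.mem_iUnion₂.1 (hcov ⟨x, hx, rfl⟩)
    refine Set.mem_iUnion₂.2 ⟨_, ⟨y, hy, rfl⟩, ?_⟩
    rw [Metric.mem_ball, dist_eq_norm, ← map_sub] at hxy ⊢
    have hn : ‖x - y‖ ≤ 2 := by
      have := norm_sub_le x y
      have h3 := mem_closedBall_zero_iff.1 hx
      have h4 := mem_closedBall_zero_iff.1 (hs hy)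
      linarith
    have h5 : ‖ContinuousLinearMap.adjoint T (x - y)‖ ^ 2
        ≤ ‖(T ∘L ContinuousLinearMap.adjoint T) (x - y)‖ * ‖x - y‖ := by
      rw [← inner_self_eq_norm_sq (𝕜 := ℂ), ContinuousLinearMap.adjoint_inner_right]
      exact re_inner_le_norm _ _
    refine lt_of_pow_lt_pow_left₀ 2 hε.le (h5.trans_lt ?_)
    have := mul_le_mul_of_nonneg_left hn
      (norm_nonneg ((T ∘L ContinuousLinearMap.adjoint T) (x - y)))
    linarith
  exact (isCompactOperator_iff_isCompact_closure_image_closedBall _ one_pos).2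
    (h2.closure.isCompact_of_isClosed isClosed_closure)

variable (H) in
/-- The ideal of the elements of `A(H)` which are compact operators on `Γ(H)`. -/
def compactIdeal : TwoSidedIdeal (scalarFieldAlgebra H) :=
  .mk' {T | IsCompactOperator (T : Fock H →L[ℂ] Fock H)} isCompactOperator_zero
    (fun hS hT => hS.add hT) (fun hT => hT.neg)
    (fun {S _} hT => hT.clm_comp (S : Fock H →L[ℂ] Fock H))
    (fun {_ T} hS => hS.comp_clm (T : Fock H →L[ℂ] Fock H))

variable (H) in
/-- The quotient of `A(H)` by its ideal of compact operators, with its canonical operations. -/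
abbrev CompactQuotient : Type _ := (compactIdeal H).ringCon.Quotient

/-- The canonical projection of `A(H)` onto the quotient. -/
def CompactQuotient.mk (T : scalarFieldAlgebra H) : CompactQuotient H := (T : CompactQuotient H)

theorem mem_compactIdeal {T : scalarFieldAlgebra H} :
    T ∈ compactIdeal H ↔ IsCompactOperator (T : Fock H →L[ℂ] Fock H) :=
  TwoSidedIdeal.mem_mk' _ _ _ _ _ _ _

theorem compactIdeal_ringCon_iff {S T : scalarFieldAlgebra H} : (compactIdeal H).ringCon S T ↔
    IsCompactOperator ((S - T : scalarFieldAlgebra H) : Fock H →L[ℂ] Fock H) :=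
  (TwoSidedIdeal.rel_iff _ _ _).trans mem_compactIdeal

instance : SMul ℂ (scalarFieldAlgebra H) := Module.toDistribMulAction.toDistribSMul.toSMulZeroClass.toSMul

/-- The scalar multiplication of the quotient. -/
instance : SMul ℂ (CompactQuotient H) where
  smul c := Quotient.map (fun T : scalarFieldAlgebra H => c • T) fun S T h => by
    have h' : IsCompactOperator (c • ((S : Fock H →L[ℂ] Fock H) - (T : Fock H →L[ℂ] Fock H))) :=
      (compactIdeal_ringCon_iff.1 h).smul c
    refine compactIdeal_ringCon_iff.2 ?_
    rw [smul_sub] at h'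
    exact h'

theorem CompactQuotient.add_mk (S T : scalarFieldAlgebra H) :
    CompactQuotient.mk S + CompactQuotient.mk T = CompactQuotient.mk (S + T) := rfl

theorem CompactQuotient.mul_mk (S T : scalarFieldAlgebra H) :
    CompactQuotient.mk S * CompactQuotient.mk T = CompactQuotient.mk (S * T) := rfl

theorem CompactQuotient.smul_mk (c : ℂ) (T : scalarFieldAlgebra H) :
    c • CompactQuotient.mk T = CompactQuotient.mk (c • T) := rfl

/-- The involution of the quotient. -/
instance : Star (CompactQuotient H) where
  star := Quotient.map star fun S T h => by
    have h' := isCompactOperator_star (compactIdeal_ringCon_iff.1 h)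
    refine compactIdeal_ringCon_iff.2 ?_
    simpa using h'

theorem CompactQuotient.star_mk (T : scalarFieldAlgebra H) :
    star (CompactQuotient.mk T) = CompactQuotient.mk (star T) := rfl

/-- The quotient norm `‖q‖ = inf {‖T‖ | T ∈ q}`. -/
instance : Norm (CompactQuotient H) where
  norm q := sInf {r | ∃ T : scalarFieldAlgebra H, CompactQuotient.mk T = q ∧ ‖T‖ = r}

/-- `P` is a canonical endomorphism of `A(H)`: `P(W(u) θ(N)) = W(u) θ(N + 1)` for `u ∈ H` and
`θ ∈ C₀(ℕ)`. -/
def IsCanonical (P : scalarFieldAlgebra H →⋆ₙₐ[ℂ] scalarFieldAlgebra H) : Prop :=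
  ∀ (u : H) (θ : C₀(ℕ, ℂ)) (T : scalarFieldAlgebra H),
    (T : Fock H →L[ℂ] Fock H) = weyl u * numberFun θ.toBCF →
      (P T : Fock H →L[ℂ] Fock H) = weyl u * numberFun (shift θ.toBCF)

end Algebras

end

end BoseFock

/-! The morphism comes from an intertwining relation. If `w` is orthogonal to `u`, then `W(u)`
commutes with `a*(w)`, and always `θ(N) a*(w) = a*(w) θ(N+1)`. Hence `W(u)θ(N) a*(w) = a*(w)
W(u)θ(N+1)`. The plan is to study the closed `*`-algebra `graphAlgebra H Set.univ` generated by the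
pairs `(W(u) z^N, W(u) z^(N+1))` and to show that it is the graph of a map with the required
properties.

Contraction. An element `(T, T')` of the algebraic span involves a finite set `E` of vectors `u`
only, so `T a*(w) = a*(w) T'` for every `w` orthogonal to `E`. In infinite dimension, a given `f`
built from finitely many vectors admits a unit `w` orthogonal to these and to `E`. Then `‖a*(w) f‖ =
‖f‖`, while `‖a*(w) g‖ ≥ ‖g‖` for all `g`, so `‖T' f‖ ≤ ‖a*(w) T' f‖ = ‖T a*(w) f‖ ≤ ‖T‖ ‖f‖`
(`norm_snd_le_of_mem_intertwiners`). The closed algebra is therefore the graph of a contractive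
`*`-morphism on `A(H)` (`exists_mem_graphAlgebra`, `eq_of_mem_graphAlgebra`).

Compact operators are killed. Taking `θ = δ₀` gives the pair `(|Ω⟩⟨Ω|, 0)`. The vectors `f` with
`(|f⟩⟨Ω|, 0)` in the graph form a closed subspace, stable under the number projections and Weyl
operators, hence under creation at each level by differentiating `W(tu)` at `t = 0`. So this
subspace is everything, and all rank one operators, then all compact ones, have image zero
(`mem_graphAlgebra_of_isCompactOperator`).

The kernel is compact. Over a finite set `E`, an element `K` with image zero satisfies `K a*(w) = 0`
for `w` orthogonal to `E`, so `K = K Γ(P)` with `P` the projection onto the span of `E`. This is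
compact, because `z^N Γ(P)` is compact and `Γ(P)` commutes with `W(u)` for `u ∈ E`. A general kernel
element is approximated by such `K`, after correcting an approximant by a lift of its small image
(`exists_norm_le_of_starHom`, `isCompactOperator_of_mem_graphAlgebra`).

Uniqueness and surjectivity follow from automatic continuity and closed range of `*`-morphisms,
checked on generators. The norm-preserving lifts also make the quotient isomorphism isometric. -/

namespace BoseFock

noncomputable section

open scoped ComplexOrder ComplexConjugate InnerProductSpace

/-! ### Morphisms of C*-algebras: optimal lifts and closed range. -/

section CStar

variable {A B : Type*} [NonUnitalCStarAlgebra A] [NonUnitalCStarAlgebra B]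

theorem continuous_starHom (φ : A →⋆ₙₐ[ℂ] B) : Continuous φ :=
  AddMonoidHomClass.continuous_of_bound φ 1 fun a => by
    simpa only [one_mul] using NonUnitalStarAlgHom.norm_apply_le φ a

/-- A `*`-morphism of `C*`-algebras lifts every element of its range without increasing its norm. -/
theorem exists_norm_le_of_starHom (φ : A →⋆ₙₐ[ℂ] B) (a : A) :
    ∃ b, φ b = φ a ∧ ‖b‖ ≤ ‖φ a‖ := by
  rcases eq_or_lt_of_le (norm_nonneg (φ a)) with h0 | hc
  · exact ⟨0, by rw [map_zero]; exact (norm_eq_zero.1 h0.symm).symm, by simp⟩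
  obtain ⟨c, hcdef⟩ : ∃ c, c = ‖φ a‖ := ⟨_, rfl⟩
  rw [← hcdef] at hc ⊢
  -- The factor `1 - k` equals `1` on `[-c², c²]` and `c/√|x|` beyond. The lift is `a(1 - k(a*a))`:
  -- the modification is invisible after `φ`, and it cuts the norm down to `c`.
  obtain ⟨k, hkdef⟩ : ∃ k : ℝ → ℝ, k = fun x => 1 - c / √(max |x| (c ^ 2)) := ⟨_, rfl⟩
  have hpos : ∀ x : ℝ, 0 < √(max |x| (c ^ 2)) := fun x =>
    Real.sqrt_pos.2 (lt_of_lt_of_le (by positivity) (le_max_right _ _))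
  have hk : Continuous k := by
    rw [hkdef]
    exact continuous_const.sub (continuous_const.div (by fun_prop) fun x => (hpos x).ne')
  have hk1 : ∀ x, |x| ≤ c ^ 2 → k x = 0 := by
    intro x hx
    simp only [hkdef, max_eq_right hx, Real.sqrt_sq hc.le, div_self hc.ne', sub_self]
  have hk0 : k 0 = 0 := hk1 0 (by rw [abs_zero]; positivity)
  have hk2 : ∀ x, |x * (1 - k x) ^ 2| ≤ c * c := by
    intro x
    have : x * (1 - k x) ^ 2 = x / max |x| (c ^ 2) * (c * c) := by
      simp only [hkdef, sub_sub_cancel, div_pow]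
      rw [Real.sq_sqrt ((sq_nonneg c).trans (le_max_right _ _))]
      ring
    have hm : 0 ≤ max |x| (c ^ 2) := (abs_nonneg x).trans (le_max_left _ _)
    rw [this, abs_mul, abs_of_nonneg (mul_nonneg hc.le hc.le), abs_div, abs_of_nonneg hm]
    exact mul_le_of_le_one_left (by positivity) (div_le_one_of_le₀ (le_max_left _ _) hm)
  clear hkdef
  obtain ⟨h, hh⟩ : ∃ h, h = star a * a := ⟨_, rfl⟩
  have hsa : IsSelfAdjoint h := hh ▸ IsSelfAdjoint.star_mul_self a
  have hs : star (cfcₙ k h) = cfcₙ k h := (cfcₙ_predicate k h : IsSelfAdjoint _)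
  refine ⟨a - a * cfcₙ k h, ?_, ?_⟩
  · have h1 : φ (cfcₙ k h) = cfcₙ k (φ h) :=
      NonUnitalStarAlgHomClass.map_cfcₙ φ k h hk.continuousOn hk0
        (continuous_starHom φ) hsa (hsa.map φ)
    -- `φ h = (φ a)* φ a` has norm `c²`, so its quasispectrum lies where `k` vanishes.
    have h2 : cfcₙ k (φ h) = 0 := by
      have : Set.EqOn k (fun _ => (0 : ℝ)) (quasispectrum ℝ (φ h)) := by
        intro x hx
        refine hk1 x ?_
        have := NonUnitalIsometricContinuousFunctionalCalculus.norm_quasispectrum_le (𝕜 := ℝ)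
          (φ h) hx (hsa.map φ)
        rwa [hh, map_mul, map_star, CStarRing.norm_star_mul_self, ← hcdef, ← sq] at this
      rw [cfcₙ_congr this, cfcₙ_const_zero]
    rw [map_sub, map_mul, h1, h2, mul_zero, sub_zero]
  · have h3 : star (a - a * cfcₙ k h) * (a - a * cfcₙ k h)
        = cfcₙ (fun x => x * (1 - k x) ^ 2) h := by
      have e : (fun x => x * (1 - k x) ^ 2)
        = fun x => (x - x * k x) - (k x * x - k x * (x * k x)) := by ext x; ring
      have c1 : Continuous fun x => x * k x := continuous_id.mul hk
      have c2 : Continuous fun x => k x * x := hk.mul continuous_id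
      have c3 : Continuous fun x => k x * (x * k x) := hk.mul c1
      rw [e, cfcₙ_sub (fun x => x - x * k x) (fun x => k x * x - k x * (x * k x)) h
          (continuous_id.sub c1).continuousOn (by simp) (c2.sub c3).continuousOn (by simp),
        cfcₙ_sub (fun x => x) (fun x => x * k x) h continuousOn_id rfl c1.continuousOn (by simp),
        cfcₙ_sub (fun x => k x * x) (fun x => k x * (x * k x)) h c2.continuousOn (by simp)
          c3.continuousOn (by simp),
        cfcₙ_mul k (fun x => x * k x) h hk.continuousOn hk0 c1.continuousOn (by simp),
        cfcₙ_mul (fun x => x) k h continuousOn_id rfl hk.continuousOn hk0,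
        cfcₙ_mul k (fun x => x) h hk.continuousOn hk0 continuousOn_id rfl, cfcₙ_id' ℝ h hsa,
        star_sub, star_mul, hs, hh]
      simp only [sub_mul, mul_sub, mul_assoc]
      exact sub_sub_sub_comm _ _ _ _
    have h4 : ‖a - a * cfcₙ k h‖ * ‖a - a * cfcₙ k h‖ ≤ c * c := by
      rw [← CStarRing.norm_star_mul_self, h3]
      exact norm_cfcₙ_le fun x _ => hk2 x
    exact abs_le_of_sq_le_sq' (by nlinarith) hc.le |>.2

/-- Lifts with uniformly bounded norm turn a convergent series in the range into the image of a
convergent series, as in the open mapping theorem. -/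
theorem isClosed_range_starHom (φ : A →⋆ₙₐ[ℂ] B) : IsClosed (Set.range φ) := by
  let f : NormedAddGroupHom A B := (AddMonoidHomClass.toAddMonoidHom φ).mkNormedAddGroupHom 1
    fun a => (NonUnitalStarAlgHom.norm_apply_le φ a).trans (one_mul _).ge
  have h : f.SurjectiveOnWith f.range 1 := by
    rintro _ ⟨a, rfl⟩
    obtain ⟨b, hb, hn⟩ := exists_norm_le_of_starHom φ a
    exact ⟨b, hb, by rw [one_mul]; exact hn⟩
  refine isClosed_of_closure_subset fun b hb => ?_
  obtain ⟨a, ha, _⟩ := controlled_closure_of_complete one_pos one_pos h b hb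
  exact ⟨a, ha⟩

end CStar

/-! ### Approximation of compact operators by sums of rank one operators. -/

section Compact

variable {E : Type*} [NormedAddCommGroup E] [InnerProductSpace ℂ E] [CompleteSpace E]

/-- The compact operators are in the closed linear span of the operators of rank one. -/
theorem mem_of_isCompactOperator {S : Submodule ℂ (E →L[ℂ] E)} (hS : IsClosed (S : Set (E →L[ℂ] E)))
    (h : ∀ f g : E, InnerProductSpace.rankOne ℂ f g ∈ S) {T : E →L[ℂ] E}
    (hT : IsCompactOperator T) : T ∈ S := by
  refine hS.closure_subset (Metric.mem_closure_iff.2 fun ε hε => ?_)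
  have h1 : TotallyBounded (T '' Metric.closedBall 0 1) :=
    (hT.isCompact_closure_image_closedBall 1).totallyBounded.subset subset_closure
  obtain ⟨s, hs, hcov⟩ := Metric.totallyBounded_iff.1 h1 (ε / 2) (by positivity)
  have := FiniteDimensional.span_of_finite ℂ hs
  let V := Submodule.span ℂ s
  -- `V` is spanned by a finite `ε/2`-net of the image of the unit ball, so projecting onto `V`
  -- moves `T x` by no more than its distance to the net.
  refine ⟨V.starProjection ∘L T, ?_, ?_⟩
  · rw [(stdOrthonormalBasis ℂ V).starProjection_eq_sum_rankOne, ContinuousLinearMap.finsetSum_comp]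
    refine S.sum_mem fun i _ => ?_
    rw [InnerProductSpace.rankOne_comp]
    exact h _ _
  rw [dist_eq_norm]
  refine lt_of_le_of_lt ?_ (half_lt_self hε)
  refine ContinuousLinearMap.opNorm_le_of_unit_norm (by positivity) fun x hx => ?_
  obtain ⟨y, hy, hxy⟩ := Set.mem_iUnion₂.1 (hcov ⟨x, by simp [hx], rfl⟩)
  rw [Metric.mem_ball, dist_eq_norm] at hxy
  refine le_trans ?_ hxy.le
  change ‖T x - V.starProjection (T x)‖ ≤ _
  rw [Submodule.starProjection_minimal]
  exact ciInf_le ⟨0, by rintro _ ⟨_, rfl⟩; exact norm_nonneg _⟩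
    (⟨y, Submodule.subset_span hy⟩ : V)

end Compact

/-! ### Creation, annihilation and second quantization on the `n`-particle spaces. -/

section SymPow

variable {H : Type*} [NormedAddCommGroup H] [InnerProductSpace ℂ H]

theorem SymPow.mem_of_mk {n : ℕ} {S : Submodule ℂ (SymPow H n)} (hS : IsClosed (S : Set (SymPow H n)))
    (h : ∀ u : Fin n → H, SymPow.mk u ∈ S) (x : SymPow H n) : x ∈ S := by
  induction x using UniformSpace.Completion.induction_on with
  | hp => exact hS
  | ih f =>
    induction f using PreSymPow.induction with
    | h0 => rw [UniformSpace.Completion.coe_zero]; exact S.zero_mem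
    | ha f g hf hg => rw [UniformSpace.Completion.coe_add]; exact S.add_mem hf hg
    | hs c u => rw [UniformSpace.Completion.coe_smul]; exact S.smul_mem c (h u)

theorem SymPow.clm_ext {n : ℕ} {E : Type*} [NormedAddCommGroup E] [NormedSpace ℂ E]
    {S T : SymPow H n →L[ℂ] E} (h : ∀ u : Fin n → H, S (.mk u) = T (.mk u)) : S = T := by
  ext x
  exact SymPow.mem_of_mk (S := LinearMap.eqLocus S.toLinearMap T.toLinearMap)
    (isClosed_eq S.continuous T.continuous) h x

theorem SymPow.ext_inner {n : ℕ} {x y : SymPow H n}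
    (h : ∀ u : Fin n → H, ⟪x, SymPow.mk u⟫_ℂ = ⟪y, SymPow.mk u⟫_ℂ) : x = y := by
  refine ext_inner_right ℂ fun z => ?_
  exact congrArg (fun T : SymPow H n →L[ℂ] ℂ => T z)
    (SymPow.clm_ext (S := innerSL ℂ x) (T := innerSL ℂ y) h)

theorem SymPow.mk_comp_perm {n : ℕ} (u : Fin n → H) (σ : Equiv.Perm (Fin n)) :
    SymPow.mk (fun i => u (σ i)) = SymPow.mk u := by
  refine SymPow.ext_inner fun v => ?_
  rw [SymPow.inner_mk, SymPow.inner_mk, ← Equiv.sum_comp (Equiv.mulRight σ)]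
  refine Finset.sum_congr rfl fun τ _ => ?_
  exact Equiv.prod_comp σ fun i => ⟪u i, v (τ i)⟫_ℂ

/-- Any factor can be moved to the front, the cyclic permutation of the indices up to `i` doing the
move. This allows factors to be treated one at a time. -/
theorem SymPow.mk_eq_creationLevel {n : ℕ} (u : Fin (n + 1) → H) (i : Fin (n + 1)) :
    SymPow.mk u = creationLevel n (u i) (.mk (i.removeNth u)) := by
  rw [creationLevel_mk, ← SymPow.mk_comp_perm u i.cycleRange.symm]
  congr 1
  ext j
  refine Fin.cases ?_ (fun j => ?_) j
  · simp
  · simp [Fin.removeNth]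

theorem SymPow.creationLevel_add (n : ℕ) (u v : H) (x : SymPow H n) :
    creationLevel n (u + v) x = creationLevel n u x + creationLevel n v x := by
  suffices h : creationLevel n (u + v) = creationLevel n u + creationLevel n v by rw [h]; rfl
  refine SymPow.clm_ext fun w => SymPow.ext_inner fun z => ?_
  simp only [_root_.add_apply, creationLevel_mk, inner_add_left]
  simp only [SymPow.mk, UniformSpace.Completion.inner_coe, PreSymPow.inner_mk, symKernel_cons,
    inner_add_left, add_mul, Finset.sum_add_distrib]

theorem SymPow.creationLevel_smul (n : ℕ) (c : ℂ) (u : H) :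
    creationLevel n (c • u) = c • creationLevel n u := by
  refine SymPow.clm_ext fun w => SymPow.ext_inner fun z => ?_
  simp only [_root_.smul_apply, creationLevel_mk, inner_smul_left]
  simp only [SymPow.mk, UniformSpace.Completion.inner_coe, PreSymPow.inner_mk, symKernel_cons,
    inner_smul_left, mul_assoc, Finset.mul_sum]

theorem creationLevel_comm (n : ℕ) (u v : H) (x : SymPow H n) :
    creationLevel (n + 1) u (creationLevel n v x) = creationLevel (n + 1) v (creationLevel n u x) := by
  suffices h : creationLevel (n + 1) u ∘L creationLevel n v
      = creationLevel (n + 1) v ∘L creationLevel n u from congrArg (fun T => T x) h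
  refine SymPow.clm_ext fun w => ?_
  simp only [ContinuousLinearMap.comp_apply, creationLevel_mk]
  have := SymPow.mk_eq_creationLevel (Fin.cons u (Fin.cons v w) : Fin (n + 2) → H) 1
  rw [this, creationLevel_mk]
  congr 1
  ext j
  refine Fin.cases ?_ (fun j => Fin.cases ?_ (fun j => ?_) j) j <;>
    simp [Fin.removeNth]

theorem adjoint_creationLevel_coe (n : ℕ) (u : H) (f : PreSymPow H (n + 1)) :
    ContinuousLinearMap.adjoint (creationLevel n u) (f : SymPow H (n + 1))
      = (preAnnihilation n u f : PreSymPow H n) := by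
  refine SymPow.ext_inner fun v => ?_
  rw [ContinuousLinearMap.adjoint_inner_left]
  have : creationLevel n u (.mk v) = ((preCreation n u (.mk v) : PreSymPow H (n + 1)) : SymPow H (n + 1)) := by
    simp [creationLevel, SymPow.mk]
  rw [this, SymPow.mk, UniformSpace.Completion.inner_coe, UniformSpace.Completion.inner_coe,
    ← inner_conj_symm, inner_preCreation, inner_conj_symm]

theorem creationLevel_coe (n : ℕ) (u : H) (f : PreSymPow H n) :
    creationLevel n u (f : SymPow H n) = (preCreation n u f : PreSymPow H (n + 1)) := by
  simp [creationLevel]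

theorem adjoint_creationLevel_zero (u v : H) (x : SymPow H 0) :
    ContinuousLinearMap.adjoint (creationLevel 0 u) (creationLevel 0 v x) = ⟪u, v⟫_ℂ • x := by
  suffices h : ContinuousLinearMap.adjoint (creationLevel 0 u) ∘L creationLevel 0 v
      = ⟪u, v⟫_ℂ • ContinuousLinearMap.id ℂ (SymPow H 0) from congrArg (fun T => T x) h
  refine SymPow.clm_ext fun w => ?_
  change ContinuousLinearMap.adjoint (creationLevel 0 u) (creationLevel 0 v (.mk w))
    = ⟪u, v⟫_ℂ • SymPow.mk w
  rw [SymPow.mk, creationLevel_coe, adjoint_creationLevel_coe, preAnnihilation_preCreation_zero,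
    UniformSpace.Completion.coe_smul]

theorem adjoint_creationLevel_succ (n : ℕ) (u v : H) (x : SymPow H (n + 1)) :
    ContinuousLinearMap.adjoint (creationLevel (n + 1) u) (creationLevel (n + 1) v x)
      = ⟪u, v⟫_ℂ • x + creationLevel n v (ContinuousLinearMap.adjoint (creationLevel n u) x) := by
  suffices h : ContinuousLinearMap.adjoint (creationLevel (n + 1) u) ∘L creationLevel (n + 1) v
      = ⟪u, v⟫_ℂ • ContinuousLinearMap.id ℂ (SymPow H (n + 1))
        + creationLevel n v ∘L ContinuousLinearMap.adjoint (creationLevel n u) from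
    congrArg (fun T => T x) h
  refine SymPow.clm_ext fun w => ?_
  change ContinuousLinearMap.adjoint (creationLevel (n + 1) u) (creationLevel (n + 1) v (.mk w))
    = ⟪u, v⟫_ℂ • SymPow.mk w
      + creationLevel n v (ContinuousLinearMap.adjoint (creationLevel n u) (.mk w))
  rw [SymPow.mk, creationLevel_coe, adjoint_creationLevel_coe, preAnnihilation_preCreation_succ,
    adjoint_creationLevel_coe, creationLevel_coe, UniformSpace.Completion.coe_add,
    UniformSpace.Completion.coe_smul]

theorem adjoint_creationLevel_mk_eq_zero (n : ℕ) (w : H) (v : Fin (n + 1) → H)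
    (h : ∀ i, ⟪w, v i⟫_ℂ = 0) :
    ContinuousLinearMap.adjoint (creationLevel n w) (.mk v) = 0 := by
  rw [SymPow.mk, adjoint_creationLevel_coe, ← UniformSpace.Completion.coe_zero]
  simp [preAnnihilation, h]

theorem norm_sq_creationLevel_zero (w : H) (x : SymPow H 0) :
    ‖creationLevel 0 w x‖ ^ 2 = (‖w‖ * ‖x‖) ^ 2 := by
  rw [← inner_self_eq_norm_sq (𝕜 := ℂ), ← ContinuousLinearMap.adjoint_inner_right,
    adjoint_creationLevel_zero, inner_smul_right, inner_self_eq_norm_sq_to_K,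
    inner_self_eq_norm_sq_to_K, ← RCLike.ofReal_pow, ← RCLike.ofReal_pow, ← RCLike.ofReal_mul,
    RCLike.ofReal_re, mul_pow]

/-- This is the commutation relation `a(w)a*(w) = ‖w‖² + a*(w)a(w)` evaluated at `x`. It yields both
the lower bound for `a*(w)` and the case of equality `a(w)x = 0` on which the norm estimate rests.
-/
theorem norm_sq_creationLevel_succ (n : ℕ) (w : H) (x : SymPow H (n + 1)) :
    ‖creationLevel (n + 1) w x‖ ^ 2
      = (‖w‖ * ‖x‖) ^ 2 + ‖ContinuousLinearMap.adjoint (creationLevel n w) x‖ ^ 2 := by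
  rw [← inner_self_eq_norm_sq (𝕜 := ℂ), ← ContinuousLinearMap.adjoint_inner_right,
    adjoint_creationLevel_succ, inner_add_right, map_add, inner_smul_right,
    ← ContinuousLinearMap.adjoint_inner_left, inner_self_eq_norm_sq, inner_self_eq_norm_sq_to_K,
    inner_self_eq_norm_sq_to_K, ← RCLike.ofReal_pow, ← RCLike.ofReal_pow, ← RCLike.ofReal_mul,
    RCLike.ofReal_re, mul_pow]

theorem norm_creationLevel_ge (n : ℕ) (w : H) (x : SymPow H n) :
    ‖w‖ * ‖x‖ ≤ ‖creationLevel n w x‖ := by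
  refine abs_le_of_sq_le_sq' ?_ (norm_nonneg _) |>.2
  cases n with
  | zero => exact (norm_sq_creationLevel_zero w x).ge
  | succ n =>
    rw [norm_sq_creationLevel_succ]
    exact le_add_of_nonneg_right (sq_nonneg _)

theorem gammaLevel_creationLevel (n : ℕ) (A : H →L[ℂ] H) (hA : ‖A‖ ≤ 1) (u : H) (x : SymPow H n) :
    gammaLevel (n + 1) A hA (creationLevel n u x) = creationLevel n (A u) (gammaLevel n A hA x) := by
  suffices h : gammaLevel (n + 1) A hA ∘L creationLevel n u
      = creationLevel n (A u) ∘L gammaLevel n A hA from congrArg (fun T => T x) h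
  refine SymPow.clm_ext fun w => ?_
  simp only [ContinuousLinearMap.comp_apply, creationLevel_mk, gammaLevel_mk]
  congr 1
  ext j
  refine Fin.cases ?_ (fun j => ?_) j <;> simp

theorem inner_gammaLevel [CompleteSpace H] (n : ℕ) (A : H →L[ℂ] H) (hA : ‖A‖ ≤ 1)
    (hsa : IsSelfAdjoint A) (x y : SymPow H n) :
    ⟪gammaLevel n A hA x, y⟫_ℂ = ⟪x, gammaLevel n A hA y⟫_ℂ := by
  suffices h : ContinuousLinearMap.adjoint (gammaLevel n A hA) = gammaLevel n A hA by
    rw [← ContinuousLinearMap.adjoint_inner_right, h]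
  refine SymPow.clm_ext fun u => SymPow.ext_inner fun v => ?_
  rw [ContinuousLinearMap.adjoint_inner_left, gammaLevel_mk, gammaLevel_mk, SymPow.inner_mk,
    SymPow.inner_mk]
  refine Finset.sum_congr rfl fun σ _ => Finset.prod_congr rfl fun i _ => ?_
  exact (hsa.isSymmetric _ _).symm

/-- Adjoint form of the commutation of `Γ(A)` with `a*(u)`, since `Γ(A)` is self-adjoint and `A`
fixes `u`. -/
theorem adjoint_creationLevel_gammaLevel [CompleteSpace H] (n : ℕ) (A : H →L[ℂ] H) (hA : ‖A‖ ≤ 1)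
    (hsa : IsSelfAdjoint A) {u : H} (hu : A u = u) (x : SymPow H (n + 1)) :
    ContinuousLinearMap.adjoint (creationLevel n u) (gammaLevel (n + 1) A hA x)
      = gammaLevel n A hA (ContinuousLinearMap.adjoint (creationLevel n u) x) := by
  refine ext_inner_right ℂ fun y => ?_
  rw [ContinuousLinearMap.adjoint_inner_left, inner_gammaLevel _ _ _ hsa, gammaLevel_creationLevel,
    hu, inner_gammaLevel _ _ _ hsa, ContinuousLinearMap.adjoint_inner_left]

theorem gammaLevel_smul_one (n : ℕ) (z : ℂ) (hz : ‖(z • 1 : H →L[ℂ] H)‖ ≤ 1) (x : SymPow H n) :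
    gammaLevel n (z • 1) hz x = z ^ n • x := by
  suffices h : gammaLevel n (z • 1) hz = z ^ n • ContinuousLinearMap.id ℂ _ by rw [h]; rfl
  refine SymPow.clm_ext fun u => SymPow.ext_inner fun v => ?_
  rw [gammaLevel_mk, _root_.smul_apply, ContinuousLinearMap.id_apply, inner_smul_left,
    SymPow.inner_mk, SymPow.inner_mk, Finset.mul_sum]
  refine Finset.sum_congr rfl fun σ _ => ?_
  simp [Finset.prod_mul_distrib, mul_comm]

end SymPow

/-! ### The closed creation operator and its relation to Weyl operators. -/

section FockOperators

open Filter Topology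

variable {H : Type*} [NormedAddCommGroup H] [InnerProductSpace ℂ H]

theorem continuous_component (n : ℕ) : Continuous fun f : Fock H => f n :=
  (lp.evalCLM ℂ (fun n => SymPow H n) 2 n).continuous

theorem Fock.mem_of_mk {S : Submodule ℂ (Fock H)} (hS : IsClosed (S : Set (Fock H)))
    (h : ∀ (n : ℕ) (u : Fin n → H), lp.single 2 n (SymPow.mk u) ∈ S) (f : Fock H) : f ∈ S := by
  have h1 : ∀ (n : ℕ) (x : SymPow H n), lp.single 2 n x ∈ S := by
    intro n x
    let L := lp.singleContinuousLinearMap ℂ (fun n => SymPow H n) 2 n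
    exact SymPow.mem_of_mk (S := S.comap L.toLinearMap) (hS.preimage L.continuous) (h n) x
  exact hS.mem_of_tendsto (lp.hasSum_single (p := 2) (by simp) f)
    (Eventually.of_forall fun s => S.sum_mem fun i _ => h1 i _)

/-- The restriction of a vector to the particle numbers below `m`. -/
def truncate (m : ℕ) (f : Fock H) : finiteParticle H :=
  finiteParticle.mk (fun n => if n < m then f n else 0) ⟨m, fun n hn => if_neg (by omega)⟩

theorem truncate_apply (m : ℕ) (f : Fock H) (n : ℕ) :
    (truncate m f : Fock H) n = if n < m then f n else 0 := rfl

theorem tendsto_truncate (f : Fock H) :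
    Tendsto (fun m => (truncate m f : Fock H)) atTop (𝓝 f) := by
  have h := (lp.hasSum_single (p := 2) (by simp) f).tendsto_sum_nat
  refine h.congr fun m => lp.ext (funext fun n => ?_)
  rw [truncate_apply, lp.coeFn_sum, Finset.sum_apply]
  split_ifs with hn
  · rw [Finset.sum_eq_single n (fun i _ hi => lp.single_apply_ne _ _ _ hi.symm)
      (fun h => absurd (Finset.mem_range.2 hn) h)]
    exact lp.single_apply_self _ _ _
  · refine Finset.sum_eq_zero fun i hi => lp.single_apply_ne _ _ _ ?_
    rintro rfl
    exact hn (Finset.mem_range.1 hi)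

/-- The graph of the closure of the creation operator `a*(w)`. -/
def creationGraph (w : H) : Submodule ℂ (Fock H × Fock H) where
  carrier := {p | p.2 0 = 0 ∧ ∀ n, p.2 (n + 1) = creationLevel n w (p.1 n)}
  zero_mem' := ⟨rfl, fun n => (map_zero (creationLevel n w)).symm⟩
  add_mem' := by
    rintro p q ⟨hp, hp'⟩ ⟨hq, hq'⟩
    refine ⟨?_, fun n => ?_⟩
    · change p.2 0 + q.2 0 = 0
      rw [hp, hq, add_zero]
    · change p.2 (n + 1) + q.2 (n + 1) = creationLevel n w (p.1 n + q.1 n)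
      rw [hp', hq', map_add]
  smul_mem' := by
    rintro c p ⟨hp, hp'⟩
    refine ⟨?_, fun n => ?_⟩
    · change c • p.2 0 = 0
      rw [hp, smul_zero]
    · change c • p.2 (n + 1) = creationLevel n w (c • p.1 n)
      rw [hp', map_smul]

/-- `a*(w)` is unbounded, but membership in its graph is a condition on each component separately,
and components are continuous. Working with the graph lets intertwining relations pass to limits. -/
theorem isClosed_creationGraph (w : H) : IsClosed (creationGraph w : Set (Fock H × Fock H)) := by
  have h : (creationGraph w : Set (Fock H × Fock H)) = {p | p.2 0 = 0} ∩
      ⋂ n, {p | p.2 (n + 1) = creationLevel n w (p.1 n)} := by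
    ext p
    simp [creationGraph]
  rw [h]
  refine IsClosed.inter (isClosed_eq ((continuous_component 0).comp continuous_snd)
    continuous_const) (isClosed_iInter fun n => isClosed_eq ((continuous_component _).comp
      continuous_snd) ((creationLevel n w).continuous.comp
        ((continuous_component n).comp continuous_fst)))

theorem mem_creationGraph (w : H) (f : finiteParticle H) :
    ((f : Fock H), (creation w f : Fock H)) ∈ creationGraph w :=
  ⟨rfl, fun _ => rfl⟩

/-- The finite particle vectors are a core for `a*(w)`, as truncation shows. -/
theorem creationGraph_subset_closure {w : H} {p : Fock H × Fock H} (hp : p ∈ creationGraph w) :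
    p ∈ closure {q | ∃ f : finiteParticle H, q = ((f : Fock H), (creation w f : Fock H))} := by
  -- Creation raises the particle number by one, so the image is truncated one level higher.
  have h : Tendsto (fun m => ((truncate m p.1 : Fock H), (truncate (m + 1) p.2 : Fock H)))
      atTop (𝓝 p) :=
    (tendsto_truncate p.1).prodMk_nhds ((tendsto_truncate p.2).comp (tendsto_add_atTop_nat 1))
  refine mem_closure_of_tendsto h (Eventually.of_forall fun m => ⟨truncate m p.1, ?_⟩)
  refine Prod.ext rfl (lp.ext (funext fun n => ?_))
  rw [truncate_apply]
  cases n with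
  | zero =>
    rw [if_pos (Nat.succ_pos m)]
    exact hp.1
  | succ n =>
    change _ = creationLevel n w ((truncate m p.1 : Fock H) n)
    rw [truncate_apply]
    by_cases hn : n < m
    · rw [if_pos (by omega), if_pos hn, hp.2]
    · rw [if_neg (by omega), if_neg hn, map_zero]

theorem norm_le_of_mem_creationGraph {w : H} {p : Fock H × Fock H} (hp : p ∈ creationGraph w) :
    ‖w‖ * ‖p.1‖ ≤ ‖p.2‖ := by
  refine abs_le_of_sq_le_sq' ?_ (norm_nonneg _) |>.2
  rw [mul_pow]
  have h1 := (hasSum_norm_sq p.1).mul_left (‖w‖ ^ 2)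
  have h2 := hasSum_norm_sq p.2
  rw [← h1.tsum_eq, ← h2.tsum_eq, h2.summable.tsum_eq_zero_add, hp.1, norm_zero,
    zero_pow two_ne_zero, zero_add]
  refine h1.summable.tsum_le_tsum (fun n => ?_)
    ((summable_nat_add_iff (f := fun n => ‖p.2 n‖ ^ 2) 1).2 h2.summable)
  rw [hp.2, ← mul_pow]
  exact pow_le_pow_left₀ (by positivity) (norm_creationLevel_ge n w _) 2

theorem norm_creation_eq {w : H} {f : finiteParticle H}
    (hf : ∀ n, ContinuousLinearMap.adjoint (creationLevel n w) ((f : Fock H) (n + 1)) = 0) :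
    ‖(creation w f : Fock H)‖ = ‖w‖ * ‖(f : Fock H)‖ := by
  rw [← sq_eq_sq₀ (norm_nonneg _) (by positivity), mul_pow]
  have h1 := (hasSum_norm_sq (f : Fock H)).mul_left (‖w‖ ^ 2)
  have h2 := hasSum_norm_sq (creation w f : Fock H)
  rw [← h1.tsum_eq, ← h2.tsum_eq, h2.summable.tsum_eq_zero_add,
    show (creation w f : Fock H) 0 = 0 from rfl, norm_zero, zero_pow two_ne_zero, zero_add]
  refine tsum_congr fun n => ?_
  change ‖creationLevel n w ((f : Fock H) n)‖ ^ 2 = _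
  rw [← mul_pow]
  cases n with
  | zero => exact norm_sq_creationLevel_zero _ _
  | succ n => rw [norm_sq_creationLevel_succ, hf, norm_zero, zero_pow two_ne_zero, add_zero]

/-- `[a(u), a*(w)] = ⟨u|w⟩` vanishes by orthogonality, and creation operators commute. -/
theorem creation_commute_field {u w : H} (h : ⟪u, w⟫_ℂ = 0) : Commute (creation w) (field u) := by
  refine LinearMap.ext fun f => Subtype.ext (lp.ext (funext fun n => ?_))
  cases n with
  | zero =>
    change 0 = ContinuousLinearMap.adjoint (creationLevel 0 u) (creationLevel 0 w (f.1 0)) + 0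
    rw [adjoint_creationLevel_zero, h, zero_smul, add_zero]
  | succ n =>
    change creationLevel n w (ContinuousLinearMap.adjoint (creationLevel n u) (f.1 (n + 1))
        + creationSeq u f.1 n)
      = ContinuousLinearMap.adjoint (creationLevel (n + 1) u) (creationLevel (n + 1) w (f.1 (n + 1)))
        + creationLevel n u (creationSeq w f.1 n)
    rw [adjoint_creationLevel_succ, h, zero_smul, zero_add, map_add]
    congr 1
    cases n with
    | zero => exact (map_zero (creationLevel 0 w)).trans (map_zero (creationLevel 0 u)).symm
    | succ n => exact creationLevel_comm n w u (f.1 n)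

theorem creation_commute_expTerm {u w : H} (h : ⟪u, w⟫_ℂ = 0) (k : ℕ) :
    Commute (creation w) (expTerm u k) :=
  (((creation_commute_field h).smul_right _).pow_right k).smul_right _

theorem hasSum_expTerm (u : H) (f : finiteParticle H) :
    HasSum (fun k => (expTerm u k f : Fock H)) (weyl u f) := hasSum_weyl u f

/-- Since `a*(w)` commutes with `φ(u)`, it commutes with every term of the exponential series on the
core. Closedness of the graph then carries this to the sum, and to all of the domain. -/
theorem weyl_mem_creationGraph {u w : H} (h : ⟪u, w⟫_ℂ = 0) {p : Fock H × Fock H}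
    (hp : p ∈ creationGraph w) : (weyl u p.1, weyl u p.2) ∈ creationGraph w := by
  have hc : IsClosed {p : Fock H × Fock H | (weyl u p.1, weyl u p.2) ∈ creationGraph w} :=
    (isClosed_creationGraph w).preimage (((weyl u).continuous.comp continuous_fst).prodMk
      ((weyl u).continuous.comp continuous_snd))
  refine hc.closure_subset_iff.2 ?_ (creationGraph_subset_closure hp)
  rintro _ ⟨f, rfl⟩
  refine (isClosed_creationGraph w).mem_of_tendsto
    ((hasSum_expTerm u f).prodMk (hasSum_expTerm u (creation w f)))
    (Eventually.of_forall fun s => (creationGraph w).sum_mem fun k _ => ?_)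
  have := congrArg (fun T : Module.End ℂ (finiteParticle H) => T f) (creation_commute_expTerm h k)
  simp only [Module.End.mul_apply] at this
  rw [← this]
  exact mem_creationGraph w _

/-! ### Scaling and adjoints of Weyl operators; commutation with second quantization. -/

theorem creation_smul (c : ℂ) (u : H) : creation (c • u) = c • creation u := by
  refine LinearMap.ext fun f => Subtype.ext (lp.ext (funext fun n => ?_))
  cases n with
  | zero => exact (smul_zero (A := SymPow H 0) c).symm
  | succ n =>
    change creationLevel n (c • u) (f.1 n) = c • creationLevel n u (f.1 n)
    rw [SymPow.creationLevel_smul]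
    rfl

theorem annihilation_smul (c : ℂ) (u : H) : annihilation (c • u) = conj c • annihilation u := by
  refine LinearMap.ext fun f => Subtype.ext (lp.ext (funext fun n => ?_))
  change ContinuousLinearMap.adjoint (creationLevel n (c • u)) (f.1 (n + 1))
    = conj c • ContinuousLinearMap.adjoint (creationLevel n u) (f.1 (n + 1))
  rw [SymPow.creationLevel_smul, map_smulₛₗ]
  rfl

theorem field_real_smul (t : ℝ) (u : H) : field ((t : ℂ) • u) = (t : ℂ) • field u := by
  rw [field, creation_smul, annihilation_smul, Complex.conj_ofReal, field, smul_add]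

theorem field_neg (u : H) : field (-u) = -field u := by
  have := field_real_smul (-1) u
  rw [Complex.ofReal_neg, Complex.ofReal_one, neg_one_smul] at this
  exact this.trans (neg_one_smul ℂ (field u))

theorem expTerm_real_smul (t : ℝ) (u : H) (k : ℕ) :
    expTerm ((t : ℂ) • u) k = (t : ℂ) ^ k • expTerm u k := by
  rw [expTerm, field_real_smul, smul_comm Complex.I, smul_pow, expTerm, smul_comm]

theorem inner_expTerm_left (u : H) (k : ℕ) (f g : finiteParticle H) :
    ⟪(expTerm u k f : Fock H), (g : Fock H)⟫_ℂ = ⟪(f : Fock H), (expTerm (-u) k g : Fock H)⟫_ℂ := by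
  have h1 : ∀ f g : finiteParticle H,
      ⟪(((Complex.I • field u) f : finiteParticle H) : Fock H), (g : Fock H)⟫_ℂ
        = ⟪(f : Fock H), (((Complex.I • field (-u)) g : finiteParticle H) : Fock H)⟫_ℂ := by
    intro f g
    rw [field_neg]
    simp only [LinearMap.smul_apply, LinearMap.neg_apply, Submodule.coe_smul, Submodule.coe_neg,
      inner_smul_left, inner_smul_right, inner_neg_right, inner_field, Complex.conj_I]
    ring
  have h2 : ∀ (k : ℕ) (f g : finiteParticle H),
      ⟪((((Complex.I • field u) ^ k) f : finiteParticle H) : Fock H), (g : Fock H)⟫_ℂ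
        = ⟪(f : Fock H), ((((Complex.I • field (-u)) ^ k) g : finiteParticle H) : Fock H)⟫_ℂ := by
    intro k
    induction k with
    | zero => intro f g; rfl
    | succ k ih =>
      intro f g
      rw [pow_succ', Module.End.mul_apply, h1, ih, pow_succ, Module.End.mul_apply]
  simp only [expTerm, LinearMap.smul_apply, Submodule.coe_smul, inner_smul_left, inner_smul_right,
    h2, map_inv₀, Complex.conj_natCast]

theorem Fock.clm_ext {E : Type*} [NormedAddCommGroup E] [NormedSpace ℂ E] {S T : Fock H →L[ℂ] E}
    (h : ∀ f : finiteParticle H, S f = T f) : S = T := by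
  ext f
  exact denseRange_finiteParticle.induction_on f (isClosed_eq S.continuous T.continuous) h

theorem star_weyl (u : H) : star (weyl u) = weyl (-u) := by
  refine Fock.clm_ext fun f => ?_
  refine ext_inner_right ℂ fun g => ?_
  -- The exponential series converges on finite particle vectors only, so density is used again, in
  -- the second variable; the two series are then compared term by term.
  refine congrArg (fun T : Fock H →L[ℂ] ℂ => T g) (Fock.clm_ext
    (S := innerSL ℂ (star (weyl u) (f : Fock H))) (T := innerSL ℂ (weyl (-u) (f : Fock H)))
    fun g => ?_)
  change ⟪ContinuousLinearMap.adjoint (weyl u) (f : Fock H), (g : Fock H)⟫_ℂ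
    = ⟪weyl (-u) (f : Fock H), (g : Fock H)⟫_ℂ
  rw [ContinuousLinearMap.adjoint_inner_left]
  have h1 := (innerSL ℂ (f : Fock H)).hasSum (hasSum_expTerm u g)
  have h2 := (innerSLFlip ℂ (g : Fock H)).hasSum (hasSum_expTerm (-u) f)
  refine h1.unique (h2.congr_fun fun k => ?_)
  have := inner_expTerm_left (-u) k f g
  rw [neg_neg] at this
  exact this.symm

/-- The restriction of `Γ(A)` to the finite particle vectors. -/
def gammaFinite (A : H →L[ℂ] H) (hA : ‖A‖ ≤ 1) : Module.End ℂ (finiteParticle H) :=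
  (Gamma A hA).toLinearMap.restrict (p := finiteParticle H) (q := finiteParticle H) <| by
    rintro f ⟨m, hm⟩
    refine ⟨m, fun n hn => ?_⟩
    change gammaLevel n A hA (f n) = 0
    rw [hm n hn, map_zero]

theorem gammaFinite_commute_field [CompleteSpace H] {A : H →L[ℂ] H} (hA : ‖A‖ ≤ 1)
    (hsa : IsSelfAdjoint A) {u : H} (hu : A u = u) : Commute (gammaFinite A hA) (field u) := by
  refine LinearMap.ext fun f => Subtype.ext (lp.ext (funext fun n => ?_))
  change gammaLevel n A hA (ContinuousLinearMap.adjoint (creationLevel n u) (f.1 (n + 1))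
      + creationSeq u f.1 n)
    = ContinuousLinearMap.adjoint (creationLevel n u) (gammaLevel (n + 1) A hA (f.1 (n + 1)))
      + creationSeq u (gammaFinite A hA f).1 n
  rw [map_add, adjoint_creationLevel_gammaLevel n A hA hsa hu]
  congr 1
  cases n with
  | zero => exact map_zero (gammaLevel 0 A hA)
  | succ n =>
    change gammaLevel (n + 1) A hA (creationLevel n u (f.1 n))
      = creationLevel n u (gammaLevel n A hA (f.1 n))
    rw [gammaLevel_creationLevel, hu]

/-- Meant for `A` the projection onto a subspace containing `u`: then `Γ(A)` commutes with `a*(u)`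
and `a(u)`, hence with each term of the exponential series. -/
theorem Gamma_commute_weyl [CompleteSpace H] {A : H →L[ℂ] H} (hA : ‖A‖ ≤ 1)
    (hsa : IsSelfAdjoint A) {u : H} (hu : A u = u) : Commute (Gamma A hA) (weyl u) := by
  refine Fock.clm_ext fun f => ?_
  change Gamma A hA (weyl u f) = weyl u (gammaFinite A hA f : Fock H)
  refine ((Gamma A hA).hasSum (hasSum_expTerm u f)).unique ?_
  convert hasSum_expTerm u (gammaFinite A hA f) using 2 with k
  have := (((gammaFinite_commute_field hA hsa hu).smul_right Complex.I).pow_right k).smul_right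
    (k.factorial : ℂ)⁻¹
  exact congrArg (fun T : Module.End ℂ (finiteParticle H) => ((T f : finiteParticle H) : Fock H)) this

end FockOperators

/-! ### Functions of the number operator and spanning families of `C₀(ℕ)`. -/

section NumberFun

open Filter Topology
open scoped BoundedContinuousFunction ZeroAtInfty

variable {H : Type*} [NormedAddCommGroup H] [InnerProductSpace ℂ H]

/-- The relation `θ(N) a*(w) = a*(w) θ(N+1)`, which is the origin of the shift in the canonical
endomorphism. -/
theorem numberFun_mem_creationGraph {w : H} (θ : ℕ →ᵇ ℂ) {p : Fock H × Fock H}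
    (hp : p ∈ creationGraph w) : (numberFun (shift θ) p.1, numberFun θ p.2) ∈ creationGraph w := by
  refine ⟨?_, fun n => ?_⟩
  · change θ 0 • p.2 0 = 0
    rw [hp.1, smul_zero]
  · change θ (n + 1) • p.2 (n + 1) = creationLevel n w (θ (n + 1) • p.1 n)
    rw [hp.2, map_smul]

theorem star_numberFun (θ : ℕ →ᵇ ℂ) : star (numberFun θ : Fock H →L[ℂ] Fock H) = numberFun (star θ) := by
  refine ContinuousLinearMap.ext fun f => ext_inner_right ℂ fun g => ?_
  rw [ContinuousLinearMap.star_eq_adjoint, ContinuousLinearMap.adjoint_inner_left,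
    lp.inner_eq_tsum, lp.inner_eq_tsum]
  refine tsum_congr fun n => ?_
  rw [numberFun_apply, numberFun_apply, inner_smul_left, inner_smul_right]
  simp

theorem norm_numberFun_le (θ : ℕ →ᵇ ℂ) : ‖(numberFun θ : Fock H →L[ℂ] Fock H)‖ ≤ ‖θ‖ := by
  unfold numberFun
  exact lp.norm_mapCLM_le 2 _ _ _

variable (H) in
/-- `θ ↦ θ(N)` as a continuous linear map. -/
def numberFunCLM : (ℕ →ᵇ ℂ) →L[ℂ] Fock H →L[ℂ] Fock H :=
  LinearMap.mkContinuous
    { toFun := numberFun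
      map_add' := fun θ η => ContinuousLinearMap.ext fun f => lp.ext (funext fun n =>
        add_smul (θ n) (η n) (f n))
      map_smul' := fun c θ => ContinuousLinearMap.ext fun f => lp.ext (funext fun n =>
        mul_smul c (θ n) (f n)) } 1
    fun θ => (norm_numberFun_le θ).trans (one_mul _).ge

theorem numberFunCLM_apply (θ : ℕ →ᵇ ℂ) : numberFunCLM H θ = numberFun θ := rfl

/-- `θ ↦ θ(· + 1)` as a continuous linear map. -/
def shiftCLM : (ℕ →ᵇ ℂ) →L[ℂ] (ℕ →ᵇ ℂ) :=
  LinearMap.mkContinuous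
    { toFun := shift
      map_add' := fun _ _ => rfl
      map_smul' := fun _ _ => rfl } 1
    fun θ => (BoundedContinuousFunction.norm_le (by positivity)).2 fun n =>
      (θ.norm_coe_le_norm (n + 1)).trans (one_mul _).ge

/-- The function `n ↦ zⁿ`. -/
def geometric (z : ℂ) (hz : ‖z‖ < 1) : ℕ →ᵇ ℂ :=
  BoundedContinuousFunction.ofNormedAddCommGroupDiscrete (fun n => z ^ n) 1 fun n => by
    rw [norm_pow]
    exact pow_le_one₀ (norm_nonneg z) hz.le

theorem geometric_apply (z : ℂ) (hz : ‖z‖ < 1) (n : ℕ) : geometric z hz n = z ^ n := rfl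

/-- The indicator function of `{k}`. -/
def delta (k : ℕ) : ℕ →ᵇ ℂ :=
  BoundedContinuousFunction.ofNormedAddCommGroupDiscrete (fun n => if n = k then 1 else 0) 1
    fun n => by split_ifs <;> simp

theorem delta_apply (k n : ℕ) : delta k n = if n = k then 1 else 0 := rfl

theorem sum_delta_apply (c : ℕ → ℂ) (m n : ℕ) :
    (∑ k ∈ Finset.range m, c k • delta k) n = if n < m then c n else 0 := by
  rw [BoundedContinuousFunction.coe_sum, Finset.sum_apply]
  simp [delta_apply]

theorem mem_of_delta {S : Submodule ℂ (ℕ →ᵇ ℂ)} (hS : IsClosed (S : Set (ℕ →ᵇ ℂ)))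
    (hd : ∀ k, delta k ∈ S) (θ : ℕ →ᵇ ℂ) (ht : Tendsto θ atTop (𝓝 0)) : θ ∈ S := by
  refine hS.closure_subset (Metric.mem_closure_iff.2 fun ε hε => ?_)
  obtain ⟨m, hm⟩ := eventually_atTop.1 (ht.norm.eventually_lt_const (u := ε / 2)
    (by rw [norm_zero]; positivity))
  refine ⟨∑ k ∈ Finset.range m, θ k • delta k,
    S.sum_mem fun k _ => S.smul_mem _ (hd k), lt_of_le_of_lt ?_ (half_lt_self hε)⟩
  rw [dist_eq_norm, BoundedContinuousFunction.norm_le (by positivity)]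
  intro n
  rw [BoundedContinuousFunction.sub_apply, sum_delta_apply]
  split_ifs with hn
  · rw [sub_self, norm_zero]
    positivity
  · rw [sub_zero]
    exact (hm n (by omega)).le

/-- `C₀(ℕ)` is the closed linear span of the geometric sequences. -/
theorem mem_of_geometric {S : Submodule ℂ (ℕ →ᵇ ℂ)} (hS : IsClosed (S : Set (ℕ →ᵇ ℂ)))
    (h : ∀ (z : ℂ) (hz : ‖z‖ < 1), geometric z hz ∈ S) (θ : ℕ →ᵇ ℂ)
    (ht : Tendsto θ atTop (𝓝 0)) : θ ∈ S := by
  refine mem_of_delta hS (fun k => ?_) θ ht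
  induction k using Nat.strong_induction_on with
  | _ k ih =>
  refine hS.closure_subset (Metric.mem_closure_iff.2 fun ε hε => ?_)
  obtain ⟨r, hr0, hr⟩ : ∃ r : ℝ, 0 < r ∧ r < min ε 1 := exists_between (lt_min hε one_pos)
  have hr1 : r < 1 := hr.trans_le (min_le_right _ _)
  have hz : ‖(r : ℂ)‖ < 1 := by rwa [Complex.norm_real, Real.norm_of_nonneg hr0.le]
  -- Once the lower coordinates are removed, `r^(-k) r^n` is `1` at `n = k` and at most `r` beyond,
  -- so the error is at most `r < ε`.
  refine ⟨((r : ℂ) ^ k)⁻¹ • (geometric r hz - ∑ j ∈ Finset.range k, (r : ℂ) ^ j • delta j),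
    S.smul_mem _ (S.sub_mem (h _ hz) (S.sum_mem fun j hj => S.smul_mem _
      (ih j (Finset.mem_range.1 hj)))), ?_⟩
  refine lt_of_le_of_lt ?_ (hr.trans_le (min_le_left _ _))
  rw [dist_eq_norm, BoundedContinuousFunction.norm_le hr0.le]
  intro n
  rw [BoundedContinuousFunction.sub_apply, BoundedContinuousFunction.smul_apply,
    BoundedContinuousFunction.sub_apply, sum_delta_apply, geometric_apply, delta_apply]
  have hrk : (r : ℂ) ^ k ≠ 0 := pow_ne_zero _ (by exact_mod_cast hr0.ne')
  rcases lt_trichotomy n k with hn | hn | hn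
  · simp [hn, hn.ne, hr0.le]
  · simp [hn, hrk, hr0.le]
  · obtain ⟨j, rfl⟩ := Nat.exists_eq_add_of_lt hn
    rw [if_neg hn.ne', if_neg (by omega), sub_zero, zero_sub, norm_neg, smul_eq_mul,
      show k + j + 1 = k + (j + 1) by ring, pow_add, inv_mul_cancel_left₀ hrk, norm_pow,
      Complex.norm_real, Real.norm_of_nonneg hr0.le]
    exact pow_le_of_le_one hr0.le hr1.le (by omega)

theorem tendsto_geometric (z : ℂ) (hz : ‖z‖ < 1) : Tendsto (geometric z hz) atTop (𝓝 0) :=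
  tendsto_pow_atTop_nhds_zero_of_norm_lt_one hz

theorem tendsto_toBCF (θ : C₀(ℕ, ℂ)) : Tendsto θ.toBCF atTop (𝓝 0) := by
  have := θ.zero_at_infty'
  rwa [Filter.cocompact_eq_cofinite, Nat.cofinite_eq_atTop] at this

theorem Gamma_smul_one {z : ℂ} (hz : ‖z‖ < 1) (h : ‖(z • 1 : H →L[ℂ] H)‖ ≤ 1) :
    Gamma (z • 1) h = numberFun (geometric z hz) :=
  ContinuousLinearMap.ext fun f => lp.ext (funext fun n => gammaLevel_smul_one n z h (f n))

end NumberFun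

/-! ### The graph algebra and its intertwining relations. -/

section Generators

set_option linter.unusedSectionVars false

variable {H : Type*} [NormedAddCommGroup H] [InnerProductSpace ℂ H] [CompleteSpace H]

variable (H) in
/-- The generators `W(u) z^N`, with `u ∈ E`, together with their images `W(u) z^(N+1)`. -/
def generatorPairs (E : Set H) : Set ((Fock H →L[ℂ] Fock H) × (Fock H →L[ℂ] Fock H)) :=
  {x | ∃ u ∈ E, ∃ (z : ℂ) (hz : ‖z‖ < 1), x = (weyl u * numberFun (geometric z hz),
    weyl u * numberFun (shift (geometric z hz)))}

theorem scalarFieldAlgebra_eq [Nontrivial H] : scalarFieldAlgebra H =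
    cstar (Prod.fst '' generatorPairs H Set.univ) := by
  have hn : ∀ z : ℂ, ‖(z • 1 : H →L[ℂ] H)‖ = ‖z‖ := fun z => by
    rw [norm_smul]
    exact (congrArg _ ContinuousLinearMap.norm_id).trans (mul_one _)
  rw [scalarFieldAlgebra, fieldAlgebra]
  congr 1
  ext T
  constructor
  · rintro ⟨u, A, hA, hA', rfl⟩
    obtain ⟨z, rfl⟩ := mem_scalars.1 hA'
    rw [hn] at hA
    exact ⟨_, ⟨u, trivial, z, hA, rfl⟩, by rw [Gamma_smul_one hA]⟩
  · rintro ⟨_, ⟨u, -, z, hz, rfl⟩, rfl⟩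
    exact ⟨u, z • 1, (hn z).trans_lt hz, mem_scalars.2 ⟨z, rfl⟩, by rw [Gamma_smul_one hz]⟩

variable (H) in
/-- The `*`-algebra generated by the pairs of generators and their images. -/
def pairAlgebra (E : Set H) :
    NonUnitalStarSubalgebra ℂ ((Fock H →L[ℂ] Fock H) × (Fock H →L[ℂ] Fock H)) :=
  NonUnitalStarAlgebra.adjoin ℂ (generatorPairs H E)

variable (H) in
/-- The graph, over the `C*`-algebra generated by `W(u) z^N` with `u ∈ E`, of the canonical
endomorphism. -/
abbrev graphAlgebra (E : Set H) :
    NonUnitalStarSubalgebra ℂ ((Fock H →L[ℂ] Fock H) × (Fock H →L[ℂ] Fock H)) :=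
  (pairAlgebra H E).topologicalClosure

/-- `T a*(w) = a*(w) T'`. -/
def Intertwines (w : H) (T T' : Fock H →L[ℂ] Fock H) : Prop :=
  ∀ p ∈ creationGraph w, (T' p.1, T p.2) ∈ creationGraph w

theorem Intertwines.add {w : H} {S S' T T' : Fock H →L[ℂ] Fock H} (h : Intertwines w S S')
    (h' : Intertwines w T T') : Intertwines w (S + T) (S' + T') :=
  fun p hp => (creationGraph w).add_mem (h p hp) (h' p hp)

theorem Intertwines.smul {w : H} {T T' : Fock H →L[ℂ] Fock H} (c : ℂ) (h : Intertwines w T T') :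
    Intertwines w (c • T) (c • T') :=
  fun p hp => (creationGraph w).smul_mem c (h p hp)

theorem Intertwines.mul {w : H} {S S' T T' : Fock H →L[ℂ] Fock H} (h : Intertwines w S S')
    (h' : Intertwines w T T') : Intertwines w (S * T) (S' * T') :=
  fun p hp => h _ (h' p hp)

/-- For each fixed `p`, evaluation of the operators is continuous and the graph of `a*(w)` is
closed. -/
theorem isClosed_intertwines (w : H) :
    IsClosed {x : (Fock H →L[ℂ] Fock H) × (Fock H →L[ℂ] Fock H) | Intertwines w x.1 x.2} := by
  simp only [Intertwines, Set.ofPred_forall]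
  refine isClosed_iInter fun p => isClosed_iInter fun _ => ?_
  exact (isClosed_creationGraph w).preimage
    ((((ContinuousLinearMap.apply ℂ (Fock H) p.1).continuous.comp continuous_snd)).prodMk
      ((ContinuousLinearMap.apply ℂ (Fock H) p.2).continuous.comp continuous_fst))

variable (H) in
/-- The pairs `(T, T')` such that `T a*(w) = a*(w) T'` and `T* a*(w) = a*(w) T'*` for all `w`
orthogonal to `E`. -/
def intertwiners (E : Set H) :
    NonUnitalStarSubalgebra ℂ ((Fock H →L[ℂ] Fock H) × (Fock H →L[ℂ] Fock H)) where
  carrier := {x | ∀ w, (∀ u ∈ E, ⟪u, w⟫_ℂ = 0) →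
    Intertwines w x.1 x.2 ∧ Intertwines w (star x.1) (star x.2)}
  zero_mem' := fun w _ => by
    have h : Intertwines w (0 : Fock H →L[ℂ] Fock H) 0 := fun p _ => (creationGraph w).zero_mem
    refine ⟨h, ?_⟩
    change Intertwines w (star (0 : Fock H →L[ℂ] Fock H)) (star (0 : Fock H →L[ℂ] Fock H))
    rwa [star_zero]
  add_mem' := fun {x y} hx hy w hw => by
    refine ⟨(hx w hw).1.add (hy w hw).1, ?_⟩
    change Intertwines w (star (x.1 + y.1)) (star (x.2 + y.2))
    rw [star_add, star_add]
    exact (hx w hw).2.add (hy w hw).2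
  smul_mem' := fun c x hx w hw => by
    refine ⟨(hx w hw).1.smul c, ?_⟩
    change Intertwines w (star (c • x.1)) (star (c • x.2))
    rw [star_smul, star_smul]
    exact (hx w hw).2.smul (star c)
  mul_mem' := fun {x y} hx hy w hw => by
    refine ⟨(hx w hw).1.mul (hy w hw).1, ?_⟩
    change Intertwines w (star (x.1 * y.1)) (star (x.2 * y.2))
    rw [star_mul, star_mul]
    exact (hy w hw).2.mul (hx w hw).2
  star_mem' := fun {x} hx w hw => by
    refine ⟨(hx w hw).2, ?_⟩
    change Intertwines w (star (star x.1)) (star (star x.2))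
    rw [star_star, star_star]
    exact (hx w hw).1

theorem mem_intertwiners {E : Set H} {x : (Fock H →L[ℂ] Fock H) × (Fock H →L[ℂ] Fock H)} :
    x ∈ intertwiners H E ↔ ∀ w, (∀ u ∈ E, ⟪u, w⟫_ℂ = 0) →
      Intertwines w x.1 x.2 ∧ Intertwines w (star x.1) (star x.2) := Iff.rfl

theorem isClosed_intertwiners (E : Set H) : IsClosed (intertwiners H E :
    Set ((Fock H →L[ℂ] Fock H) × (Fock H →L[ℂ] Fock H))) := by
  have e : (intertwiners H E : Set ((Fock H →L[ℂ] Fock H) × (Fock H →L[ℂ] Fock H))) = ⋂ (w : H) (_ : ∀ u ∈ E, ⟪u, w⟫_ℂ = 0),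
      {x | Intertwines w x.1 x.2} ∩ star ⁻¹' {x | Intertwines w x.1 x.2} := by
    ext x
    simp only [SetLike.mem_coe, mem_intertwiners, Set.mem_iInter]
    rfl
  rw [e]
  exact isClosed_iInter fun w => isClosed_iInter fun _ => (isClosed_intertwines w).inter
    ((isClosed_intertwines w).preimage continuous_star)

theorem pairAlgebra_le_intertwiners (E : Set H) : pairAlgebra H E ≤ intertwiners H E := by
  refine NonUnitalStarAlgebra.adjoin_le ?_
  rintro _ ⟨u, hu, z, hz, rfl⟩ w hw
  refine ⟨fun p hp => ?_, fun p hp => ?_⟩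
  · exact weyl_mem_creationGraph (hw u hu) (numberFun_mem_creationGraph _ hp)
  · rw [star_mul, star_mul, star_weyl, star_numberFun, star_numberFun]
    refine numberFun_mem_creationGraph (star (geometric z hz)) (weyl_mem_creationGraph ?_ hp)
    rw [inner_neg_left, hw u hu, neg_zero]

theorem graphAlgebra_le_intertwiners (E : Set H) : graphAlgebra H E ≤ intertwiners H E :=
  NonUnitalStarSubalgebra.topologicalClosure_minimal _ (pairAlgebra_le_intertwiners E)
    (isClosed_intertwiners E)

theorem pairAlgebra_mono {E F : Set H} (h : E ⊆ F) : pairAlgebra H E ≤ pairAlgebra H F :=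
  NonUnitalStarAlgebra.adjoin_mono fun _ ⟨u, hu, h'⟩ => ⟨u, h hu, h'⟩

/-- A finite set of vectors leaves room for some `w` orthogonal to it; this would fail for
`Set.univ`. -/
theorem exists_finite_mem_pairAlgebra {x : (Fock H →L[ℂ] Fock H) × (Fock H →L[ℂ] Fock H)}
    (hx : x ∈ pairAlgebra H Set.univ) : ∃ E : Set H, E.Finite ∧ x ∈ pairAlgebra H E := by
  induction hx using NonUnitalStarAlgebra.adjoin_induction with
  | mem x hx =>
    obtain ⟨u, -, h⟩ := hx
    exact ⟨{u}, Set.finite_singleton u, NonUnitalStarAlgebra.subset_adjoin ℂ _ ⟨u, rfl, h⟩⟩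
  | zero => exact ⟨∅, Set.finite_empty, zero_mem _⟩
  | add x y _ _ hx hy =>
    obtain ⟨E, hE, hx⟩ := hx
    obtain ⟨F, hF, hy⟩ := hy
    exact ⟨E ∪ F, hE.union hF, add_mem (pairAlgebra_mono Set.subset_union_left hx)
      (pairAlgebra_mono Set.subset_union_right hy)⟩
  | mul x y _ _ hx hy =>
    obtain ⟨E, hE, hx⟩ := hx
    obtain ⟨F, hF, hy⟩ := hy
    exact ⟨E ∪ F, hE.union hF, mul_mem (pairAlgebra_mono Set.subset_union_left hx)
      (pairAlgebra_mono Set.subset_union_right hy)⟩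
  | smul c x _ hx =>
    obtain ⟨E, hE, hx⟩ := hx
    exact ⟨E, hE, SMulMemClass.smul_mem c hx⟩
  | star x _ hx =>
    obtain ⟨E, hE, hx⟩ := hx
    exact ⟨E, hE, star_mem hx⟩

/-! ### The second component of the graph is dominated by the first. -/

/-- The finite particle vectors which are annihilated by `a(w)` for all `w` orthogonal to some
finite set. -/
def localizedVectors (H : Type*) [NormedAddCommGroup H] [InnerProductSpace ℂ H] :
    Submodule ℂ (Fock H) where
  carrier := {f | f ∈ finiteParticle H ∧ ∃ F : Set H, F.Finite ∧ ∀ w, (∀ u ∈ F, ⟪u, w⟫_ℂ = 0) →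
    ∀ n, ContinuousLinearMap.adjoint (creationLevel n w) (f (n + 1)) = 0}
  zero_mem' := ⟨Submodule.zero_mem _, ∅, Set.finite_empty, fun w _ n =>
    map_zero (ContinuousLinearMap.adjoint (creationLevel n w))⟩
  add_mem' := by
    rintro f g ⟨hf, F, hF, hf'⟩ ⟨hg, G, hG, hg'⟩
    refine ⟨Submodule.add_mem _ hf hg, F ∪ G, hF.union hG, fun w hw n => ?_⟩
    change ContinuousLinearMap.adjoint (creationLevel n w) (f (n + 1) + g (n + 1)) = 0
    rw [map_add, hf' w (fun u hu => hw u (Or.inl hu)), hg' w (fun u hu => hw u (Or.inr hu)),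
      add_zero]
  smul_mem' := by
    rintro c f ⟨hf, F, hF, hf'⟩
    refine ⟨Submodule.smul_mem _ c hf, F, hF, fun w hw n => ?_⟩
    change ContinuousLinearMap.adjoint (creationLevel n w) (c • f (n + 1)) = 0
    rw [map_smul, hf' w hw, smul_zero]

/-- A product `u₁ ⋯ uₙ` is annihilated by `a(w)` as soon as `w` is orthogonal to all its factors,
and products span a dense subspace. -/
theorem dense_localizedVectors (f : Fock H) : f ∈ closure (localizedVectors H : Set (Fock H)) := by
  refine Fock.mem_of_mk (S := (localizedVectors H).topologicalClosure)
    (Submodule.isClosed_topologicalClosure _) (fun n u => ?_) f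
  refine subset_closure ⟨⟨n + 1, fun m hm => lp.single_apply_ne _ _ _ (by omega)⟩, Set.range u,
    Set.finite_range u, fun w hw m => ?_⟩
  by_cases hm : m + 1 = n
  · subst hm
    rw [lp.single_apply_self]
    refine adjoint_creationLevel_mk_eq_zero m w u fun i => ?_
    rw [← inner_conj_symm, hw _ ⟨i, rfl⟩, map_zero]
  · rw [lp.single_apply_ne _ _ _ hm, map_zero]

theorem exists_unit_orthogonal (hH : ¬ FiniteDimensional ℂ H) {F : Set H} (hF : F.Finite) :
    ∃ w : H, ‖w‖ = 1 ∧ ∀ u ∈ F, ⟪u, w⟫_ℂ = 0 := by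
  have := FiniteDimensional.span_of_finite ℂ hF
  obtain ⟨w, hw, hw0⟩ : ∃ w ∈ (Submodule.span ℂ F)ᗮ, w ≠ 0 := by
    refine Submodule.exists_mem_ne_zero_of_ne_bot fun h => hH ?_
    rw [Submodule.orthogonal_eq_bot_iff] at h
    rw [h] at this
    exact LinearEquiv.finiteDimensional Submodule.topEquiv
  refine ⟨((‖w‖ : ℂ)⁻¹) • w, ?_, fun u hu => ?_⟩
  · exact norm_smul_inv_norm hw0
  · rw [inner_smul_right, (Submodule.mem_orthogonal _ _).1 hw u (Submodule.subset_span hu),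
      mul_zero]

/-- For localized `f`, take a unit `w` orthogonal to `E` and to the vectors localizing `f`. Then
`a*(w)` preserves the norm of `f` and does not decrease that of `T' f`, so `‖T' f‖ ≤ ‖a*(w) T' f‖ =
‖T a*(w) f‖ ≤ ‖T‖ ‖f‖`. -/
theorem norm_snd_le_of_mem_intertwiners (hH : ¬ FiniteDimensional ℂ H) {E : Set H} (hE : E.Finite)
    {x : (Fock H →L[ℂ] Fock H) × (Fock H →L[ℂ] Fock H)} (hx : x ∈ intertwiners H E) :
    ‖x.2‖ ≤ ‖x.1‖ := by
  refine ContinuousLinearMap.opNorm_le_bound _ (norm_nonneg _) fun f => ?_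
  refine (isClosed_le (by fun_prop) (by fun_prop) :
    IsClosed {f | ‖x.2 f‖ ≤ ‖x.1‖ * ‖f‖}).closure_subset_iff.2 ?_ (dense_localizedVectors f)
  rintro f ⟨hf, F, hF, hf'⟩
  obtain ⟨w, hw, hw'⟩ := exists_unit_orthogonal hH (hE.union hF)
  have h1 := norm_le_of_mem_creationGraph
    ((hx w fun u hu => hw' u (Or.inl hu)).1 _ (mem_creationGraph w ⟨f, hf⟩))
  rw [hw, one_mul] at h1
  refine h1.trans ((x.1.le_opNorm _).trans ?_)
  rw [norm_creation_eq (f := ⟨f, hf⟩) (hf' w fun u hu => hw' u (Or.inr hu)), hw, one_mul]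

theorem norm_snd_le_of_mem_graphAlgebra (hH : ¬ FiniteDimensional ℂ H)
    {x : (Fock H →L[ℂ] Fock H) × (Fock H →L[ℂ] Fock H)} (hx : x ∈ graphAlgebra H Set.univ) :
    ‖x.2‖ ≤ ‖x.1‖ := by
  refine (isClosed_le (by fun_prop) (by fun_prop) : IsClosed {x : (Fock H →L[ℂ] Fock H) ×
    (Fock H →L[ℂ] Fock H) | ‖x.2‖ ≤ ‖x.1‖}).closure_subset_iff.2 ?_ hx
  intro y hy
  obtain ⟨E, hE, hy⟩ := exists_finite_mem_pairAlgebra hy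
  exact norm_snd_le_of_mem_intertwiners hH hE (pairAlgebra_le_intertwiners E hy)

end Generators

/-! ### Elements of the graph with vanishing image are compact. -/

section Kernel

set_option linter.unusedSectionVars false

open Filter Topology
open scoped BoundedContinuousFunction ZeroAtInfty

variable {H : Type*} [NormedAddCommGroup H] [InnerProductSpace ℂ H] [CompleteSpace H]

/-- Symmetric powers of a finite-dimensional space are finite-dimensional: the space for `n + 1` is
the sum, over `e ∈ E`, of the images of the space for `n` under multiplication by `e`. -/
theorem exists_finiteDimensional_mk_mem {E : Set H} (hE : E.Finite) (n : ℕ) :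
    ∃ W : Submodule ℂ (SymPow H n), FiniteDimensional ℂ W ∧
      ∀ v : Fin n → H, (∀ i, v i ∈ Submodule.span ℂ E) → SymPow.mk v ∈ W := by
  induction n with
  | zero =>
    refine ⟨Submodule.span ℂ {SymPow.mk 0}, inferInstance, fun v _ => ?_⟩
    rw [Subsingleton.elim v 0]
    exact Submodule.mem_span_singleton_self _
  | succ n ih =>
    obtain ⟨W, hW, h⟩ := ih
    have := hE.to_subtype
    refine ⟨⨆ e : E, W.map (creationLevel n (e : H)).toLinearMap, inferInstance, fun v hv => ?_⟩
    rw [SymPow.mk_eq_creationLevel v 0]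
    have hx : SymPow.mk (Fin.removeNth 0 v) ∈ W := h _ fun i => hv _
    refine Submodule.span_induction (p := fun u _ => creationLevel n u (.mk (Fin.removeNth 0 v)) ∈
      ⨆ e : E, W.map (creationLevel n (e : H)).toLinearMap) ?_ ?_ ?_ ?_ (hv 0)
    · intro e he
      exact Submodule.mem_iSup_of_mem (⟨e, he⟩ : E) (Submodule.mem_map_of_mem hx)
    · have : creationLevel n (0 : H) = 0 := by
        have := SymPow.creationLevel_smul n 0 (0 : H)
        rwa [zero_smul, zero_smul] at this
      rw [this]
      exact Submodule.zero_mem _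
    · intro u u' _ _ hu hu'
      rw [SymPow.creationLevel_add]
      exact Submodule.add_mem _ hu hu'
    · intro c u _ hu
      rw [SymPow.creationLevel_smul]
      exact Submodule.smul_mem _ c hu

theorem isCompactOperator_of_forall_mem {V F : Type*} [NormedAddCommGroup V] [NormedSpace ℂ V]
    [NormedAddCommGroup F] [NormedSpace ℂ F] (T : V →L[ℂ] F) (W : Submodule ℂ F)
    [FiniteDimensional ℂ W] (h : ∀ x, T x ∈ W) : IsCompactOperator T := by
  have := FiniteDimensional.proper ℂ W
  have h1 : IsCompactOperator (T.codRestrict W h) :=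
    isCompactOperator_of_locallyCompactSpace_dom (T.codRestrict W h)
  exact h1.clm_comp W.subtypeL

/-- The orthogonal projection onto the linear span of a finite set. -/
def spanProj (E : Finset H) : H →L[ℂ] H := (Submodule.span ℂ (E : Set H)).starProjection

theorem norm_spanProj_le (E : Finset H) : ‖spanProj E‖ ≤ 1 := Submodule.starProjection_norm_le _

theorem isSelfAdjoint_spanProj (E : Finset H) : IsSelfAdjoint (spanProj E) :=
  isSelfAdjoint_starProjection _

theorem spanProj_eq_self {E : Finset H} {u : H} (hu : u ∈ E) : spanProj E u = u :=
  Submodule.starProjection_eq_self_iff.2 (Submodule.subset_span hu)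

theorem inner_sub_spanProj {E : Finset H} {u : H} (hu : u ∈ E) (v : H) :
    ⟪u, v - spanProj E v⟫_ℂ = 0 :=
  (Submodule.mem_orthogonal _ _).1 (Submodule.sub_starProjection_mem_orthogonal v) u
    (Submodule.subset_span hu)

theorem isCompactOperator_gammaLevel (E : Finset H) (n : ℕ) :
    IsCompactOperator (gammaLevel n (spanProj E) (norm_spanProj_le E)) := by
  obtain ⟨W, hW, h⟩ := exists_finiteDimensional_mk_mem E.finite_toSet n
  refine isCompactOperator_of_forall_mem _ W fun x => ?_
  let L := gammaLevel n (spanProj E) (norm_spanProj_le E)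
  refine SymPow.mem_of_mk (S := W.comap L.toLinearMap)
    (W.closed_of_finiteDimensional.preimage L.continuous) (fun u => ?_) x
  change L (.mk u) ∈ W
  rw [gammaLevel_mk]
  exact h _ fun i => Submodule.starProjection_apply_mem _ _

theorem isClosed_isCompactOperator {V : Type*} [NormedAddCommGroup V] [NormedSpace ℂ V]
    [CompleteSpace V] : IsClosed {T : V →L[ℂ] V | IsCompactOperator T} :=
  isClosed_setOfPred_isCompactOperator

/-- At each level `Γ(P)` has finite rank, and decay of `θ` makes the sum over levels converge in
norm; it is enough to treat `θ = δ_k`. -/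
theorem isCompactOperator_numberFun_mul_Gamma (E : Finset H) (θ : ℕ →ᵇ ℂ)
    (hθ : Tendsto θ atTop (𝓝 0)) :
    IsCompactOperator
      (numberFun θ * Gamma (spanProj E) (norm_spanProj_le E) : Fock H →L[ℂ] Fock H) := by
  let Q := Gamma (spanProj E) (norm_spanProj_le E)
  let S : Submodule ℂ (ℕ →ᵇ ℂ) :=
    (compactOperator (RingHom.id ℂ) (Fock H) (Fock H)).comap
      (((ContinuousLinearMap.mul ℂ (Fock H →L[ℂ] Fock H)).flip Q ∘L numberFunCLM H).toLinearMap)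
  have hS : IsClosed (S : Set (ℕ →ᵇ ℂ)) :=
    isClosed_isCompactOperator.preimage
      ((ContinuousLinearMap.mul ℂ (Fock H →L[ℂ] Fock H)).flip Q ∘L numberFunCLM H).continuous
  refine mem_of_delta hS (fun k => ?_) θ hθ
  change IsCompactOperator (numberFun (delta k) * Q : Fock H →L[ℂ] Fock H)
  have e : (numberFun (delta k) * Q : Fock H →L[ℂ] Fock H) = (lp.singleContinuousLinearMap ℂ (fun n => SymPow H n) 2 k ∘L
      gammaLevel k (spanProj E) (norm_spanProj_le E)) ∘L lp.evalCLM ℂ (fun n => SymPow H n) 2 k := by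
    refine ContinuousLinearMap.ext fun f => lp.ext (funext fun n => ?_)
    change (if n = k then (1 : ℂ) else 0) • gammaLevel n (spanProj E) (norm_spanProj_le E) (f n)
      = lp.single (E := fun n => SymPow H n) 2 k (gammaLevel k (spanProj E) (norm_spanProj_le E) (f k)) n
    split_ifs with h
    · subst h
      rw [one_smul, lp.single_apply_self]
    · rw [zero_smul, lp.single_apply_ne _ _ _ h]
  rw [e]
  exact ((isCompactOperator_gammaLevel E k).clm_comp
    (lp.singleContinuousLinearMap ℂ (fun n => SymPow H n) 2 k)).comp_clm
      (lp.evalCLM ℂ (fun n => SymPow H n) 2 k)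

theorem tendsto_star {θ : ℕ →ᵇ ℂ} (hθ : Tendsto θ atTop (𝓝 0)) :
    Tendsto (star θ : ℕ →ᵇ ℂ) atTop (𝓝 0) := by
  have := hθ.star
  rwa [star_zero] at this

theorem isCompactOperator_fst_mul_Gamma (E : Finset H)
    {x : (Fock H →L[ℂ] Fock H) × (Fock H →L[ℂ] Fock H)} (hx : x ∈ graphAlgebra H (E : Set H)) :
    IsCompactOperator (x.1 * Gamma (spanProj E) (norm_spanProj_le E)) := by
  obtain ⟨Q, hQ⟩ : ∃ Q, Q = Gamma (spanProj E) (norm_spanProj_le E) := ⟨_, rfl⟩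
  rw [← hQ]
  have hc : IsClosed {x : (Fock H →L[ℂ] Fock H) × (Fock H →L[ℂ] Fock H) |
      IsCompactOperator (x.1 * Q)} :=
    isClosed_isCompactOperator.preimage
      (((ContinuousLinearMap.mul ℂ (Fock H →L[ℂ] Fock H)).flip Q).continuous.comp continuous_fst)
  refine hc.closure_subset_iff.2 ?_ hx
  intro x hx
  -- Compactness of `T* Q` does not follow from that of `T Q`, so both are carried through the
  -- induction to handle the star.
  suffices h : IsCompactOperator (x.1 * Q) ∧ IsCompactOperator (star x.1 * Q) from h.1
  induction hx using NonUnitalStarAlgebra.adjoin_induction with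
  | mem x hx =>
    obtain ⟨u, hu, z, hz, rfl⟩ := hx
    constructor
    · change IsCompactOperator (weyl u * numberFun (geometric z hz) * Q : Fock H →L[ℂ] Fock H)
      rw [mul_assoc, hQ]
      exact (isCompactOperator_numberFun_mul_Gamma E _ (tendsto_geometric z hz)).clm_comp (weyl u)
    · change IsCompactOperator (star (weyl u * numberFun (geometric z hz)) * Q : Fock H →L[ℂ] Fock H)
      -- In `(W(u) z^N)*` the Weyl operator stands next to `Q`; commuting them brings `Q` next to
      -- the function of `N`.
      have hcm : Commute (Gamma (spanProj E) (norm_spanProj_le E)) (weyl (-u)) :=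
        Gamma_commute_weyl _ (isSelfAdjoint_spanProj E) (by rw [map_neg, spanProj_eq_self hu])
      rw [star_mul, star_numberFun, star_weyl, mul_assoc, hQ, ← hcm.eq, ← mul_assoc]
      exact (isCompactOperator_numberFun_mul_Gamma E _
        (tendsto_star (tendsto_geometric z hz))).comp_clm (weyl (-u))
  | zero =>
    have h0 : IsCompactOperator (0 * Q : Fock H →L[ℂ] Fock H) := by
      rw [zero_mul]
      exact isCompactOperator_zero
    refine ⟨h0, ?_⟩
    change IsCompactOperator (star (0 : Fock H →L[ℂ] Fock H) * Q)
    rwa [star_zero]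
  | add x y _ _ hx hy =>
    constructor
    · change IsCompactOperator ((x.1 + y.1) * Q)
      rw [add_mul]
      exact hx.1.add hy.1
    · change IsCompactOperator (star (x.1 + y.1) * Q)
      rw [star_add, add_mul]
      exact hx.2.add hy.2
  | mul x y _ _ hx hy =>
    constructor
    · change IsCompactOperator (x.1 * y.1 * Q)
      rw [mul_assoc]
      exact hy.1.clm_comp x.1
    · change IsCompactOperator (star (x.1 * y.1) * Q)
      rw [star_mul, mul_assoc]
      exact hx.2.clm_comp (star y.1)
  | smul c x _ hx =>
    constructor
    · change IsCompactOperator (c • x.1 * Q)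
      rw [smul_mul_assoc]
      exact hx.1.smul c
    · change IsCompactOperator (star (c • x.1) * Q)
      rw [star_smul, smul_mul_assoc]
      exact hx.2.smul (star c)
  | star x _ hx =>
    refine ⟨hx.2, ?_⟩
    change IsCompactOperator (star (star x.1) * Q)
    rw [star_star]
    exact hx.1

theorem single_mem_creationGraph (w : H) (n : ℕ) (x : SymPow H n) :
    ((lp.single 2 n x, lp.single 2 (n + 1) (creationLevel n w x)) : Fock H × Fock H)
      ∈ creationGraph w := by
  refine ⟨lp.single_apply_ne _ _ _ (by omega), fun m => ?_⟩
  change lp.single (E := fun n => SymPow H n) 2 (n + 1) (creationLevel n w x) (m + 1)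
    = creationLevel m w (lp.single (E := fun n => SymPow H n) 2 n x m)
  by_cases h : m = n
  · subst h
    rw [lp.single_apply_self, lp.single_apply_self]
  · rw [lp.single_apply_ne _ _ _ (by omega), lp.single_apply_ne _ _ _ h, map_zero]

/-- The intertwining relation reads `K a*(w) = 0` for `w` orthogonal to `E`, so `K` kills every
product having such a factor. The factors of a product may then be replaced by their projections
onto the span of `E`, one after another. -/
theorem eq_mul_Gamma_of_mem (E : Finset H) {K : Fock H →L[ℂ] Fock H}
    (hK : ((K, 0) : (Fock H →L[ℂ] Fock H) × (Fock H →L[ℂ] Fock H)) ∈ intertwiners H (E : Set H)) :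
    K = K * Gamma (spanProj E) (norm_spanProj_le E) := by
  have h0 : ∀ (w : H), (∀ u ∈ E, ⟪u, w⟫_ℂ = 0) → ∀ (n : ℕ) (x : SymPow H n),
      K (lp.single 2 (n + 1) (creationLevel n w x)) = 0 := by
    intro w hw n x
    have h := (hK w hw).1 _ (single_mem_creationGraph w n x)
    refine lp.ext (funext fun m => ?_)
    cases m with
    | zero => exact h.1
    | succ m => exact (h.2 m).trans (map_zero (creationLevel m w))
  have h1 : ∀ (n : ℕ) (u : Fin n → H) (s : Finset (Fin n)),
      K (lp.single 2 n (SymPow.mk u))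
        = K (lp.single 2 n (SymPow.mk fun i => if i ∈ s then spanProj E (u i) else u i)) := by
    intro n u s
    induction s using Finset.induction_on with
    | empty => simp
    | insert j s hj ih =>
      rw [ih]
      obtain ⟨m, rfl⟩ : ∃ m, n = m + 1 := ⟨n - 1, by have := j.pos; omega⟩
      rw [SymPow.mk_eq_creationLevel _ j, SymPow.mk_eq_creationLevel
        (fun i => if i ∈ insert j s then spanProj E (u i) else u i) j]
      have e : j.removeNth (fun i => if i ∈ insert j s then spanProj E (u i) else u i)
          = j.removeNth (fun i => if i ∈ s then spanProj E (u i) else u i) := by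
        ext i
        simp [Fin.removeNth, Fin.succAbove_ne]
      rw [e, if_neg hj, if_pos (Finset.mem_insert_self j s)]
      -- The factor `u j` splits into its projection and a remainder orthogonal to `E`, which `K`
      -- ignores.
      have h2 := h0 (u j - spanProj E (u j)) (fun v hv => inner_sub_spanProj hv _) m
        (.mk (j.removeNth fun i => if i ∈ s then spanProj E (u i) else u i))
      have h3 := SymPow.creationLevel_add m (u j - spanProj E (u j)) (spanProj E (u j))
        (.mk (j.removeNth fun i => if i ∈ s then spanProj E (u i) else u i))
      rw [sub_add_cancel] at h3
      rw [h3, lp.single_add, map_add, h2, zero_add]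
  refine ContinuousLinearMap.ext fun f => ?_
  refine Fock.mem_of_mk (S := LinearMap.eqLocus K.toLinearMap
    (K * Gamma (spanProj E) (norm_spanProj_le E)).toLinearMap)
    (isClosed_eq K.continuous (K * Gamma _ (norm_spanProj_le E)).continuous) (fun n u => ?_) f
  change K (lp.single 2 n (SymPow.mk u)) = K (Gamma _ (norm_spanProj_le E) (lp.single 2 n (SymPow.mk u)))
  rw [h1 n u Finset.univ]
  congr 1
  refine lp.ext (funext fun m => ?_)
  change _ = gammaLevel m _ (norm_spanProj_le E) (lp.single (E := fun n => SymPow H n) 2 n (SymPow.mk u) m)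
  by_cases h : m = n
  · subst h
    rw [lp.single_apply_self, lp.single_apply_self, gammaLevel_mk]
    simp
  · rw [lp.single_apply_ne _ _ _ h, lp.single_apply_ne _ _ _ h, map_zero]

/-- An element of the graph with vanishing image is compact. -/
theorem isCompactOperator_of_mem_graphAlgebra {T : Fock H →L[ℂ] Fock H}
    (hT : ((T, 0) : (Fock H →L[ℂ] Fock H) × (Fock H →L[ℂ] Fock H)) ∈ graphAlgebra H Set.univ) :
    IsCompactOperator T := by
  refine isClosed_isCompactOperator.closure_subset (Metric.mem_closure_iff.2 fun ε hε => ?_)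
  obtain ⟨y, hy, hd⟩ := Metric.mem_closure_iff.1 hT (ε / 2) (by positivity)
  obtain ⟨E, hE, hyE⟩ := exists_finite_mem_pairAlgebra hy
  lift E to Finset H using hE
  have : IsClosed (graphAlgebra H (E : Set H) :
      Set ((Fock H →L[ℂ] Fock H) × (Fock H →L[ℂ] Fock H))) :=
    NonUnitalStarSubalgebra.isClosed_topologicalClosure _
  let φ : graphAlgebra H (E : Set H) →⋆ₙₐ[ℂ] (Fock H →L[ℂ] Fock H) :=
    (NonUnitalStarAlgHom.snd ℂ _ _).comp (NonUnitalStarSubalgebraClass.subtype _)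
  -- The approximant `y` has small, but perhaps nonzero, image `y.2`. Lifting that image within the
  -- closed algebra over `E` without increase of norm gives a small correction `z`, and `y - z` is
  -- an exact kernel element over a finite set.
  obtain ⟨z, hz, hzn⟩ := exists_norm_le_of_starHom φ
    ⟨y, NonUnitalStarSubalgebra.le_topologicalClosure _ hyE⟩
  have hz' : z.1.2 = y.2 := hz
  have hzn' : ‖z.1‖ ≤ ‖y.2‖ := hzn
  have hK : ((y.1 - z.1.1, 0) : (Fock H →L[ℂ] Fock H) × (Fock H →L[ℂ] Fock H))
      ∈ graphAlgebra H (E : Set H) := by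
    have := sub_mem (NonUnitalStarSubalgebra.le_topologicalClosure _ hyE) z.2
    have e : y - z.1 = (y.1 - z.1.1, 0) := Prod.ext rfl (by
      change y.2 - z.1.2 = 0
      rw [hz', sub_self])
    rwa [e] at this
  refine ⟨y.1 - z.1.1, ?_, ?_⟩
  · change IsCompactOperator (y.1 - z.1.1)
    rw [eq_mul_Gamma_of_mem E (graphAlgebra_le_intertwiners _ hK)]
    exact isCompactOperator_fst_mul_Gamma E hK
  · rw [Prod.dist_eq, max_lt_iff] at hd
    have h2 : ‖y.2‖ < ε / 2 := by
      have := hd.2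
      rwa [dist_comm, dist_zero_right] at this
    have h1 : ‖T - y.1‖ < ε / 2 := by rw [← dist_eq_norm]; exact hd.1
    have h3 : ‖z.1.1‖ ≤ ‖z.1‖ := norm_fst_le _
    rw [dist_eq_norm, ← sub_add]
    have := norm_add_le (T - y.1) z.1.1
    linarith

end Kernel

/-! ### Compact operators belong to the graph, with image zero. -/

section CompactOperators

set_option linter.unusedSectionVars false

open Filter Topology InnerProductSpace
open scoped BoundedContinuousFunction ZeroAtInfty

/-- The coefficient `e 1` is the derivative at zero of the power series, a limit of difference
quotients lying in `S`. It serves to extract `iφ(u)f` from the vectors `W(tu)f`. -/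
theorem coeff_one_mem {V : Type*} [NormedAddCommGroup V] [NormedSpace ℂ V] [CompleteSpace V]
    {S : Submodule ℂ V} (hS : IsClosed (S : Set V)) {e : ℕ → V} (he : Summable fun k => ‖e k‖)
    (h0 : e 0 ∈ S) (h : ∀ t : ℝ, ∑' k, (t : ℂ) ^ k • e k ∈ S) : e 1 ∈ S := by
  have hC : 0 ≤ ∑' k, ‖e k‖ := tsum_nonneg fun k => norm_nonneg _
  refine hS.closure_subset (Metric.mem_closure_iff.2 fun ε hε => ?_)
  -- The difference quotient misses `e 1` by at most `t ∑ ‖e k‖`; adding one to the sum keeps the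
  -- denominator positive.
  obtain ⟨t, ht0, ht⟩ : ∃ t : ℝ, 0 < t ∧ t < min 1 (ε / (∑' k, ‖e k‖ + 1)) :=
    exists_between (lt_min one_pos (by positivity))
  have ht1 : t ≤ 1 := (ht.trans_le (min_le_left _ _)).le
  have htε := ht.trans_le (min_le_right _ _)
  rw [lt_div_iff₀ (by positivity)] at htε
  have htn : ∀ k, ‖(t : ℂ) ^ k‖ ≤ 1 := fun k => by
    rw [norm_pow, Complex.norm_real, Real.norm_of_nonneg ht0.le]
    exact pow_le_one₀ ht0.le ht1
  have hs : Summable fun k => (t : ℂ) ^ k • e k := by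
    refine Summable.of_norm_bounded he fun k => ?_
    rw [norm_smul]
    exact mul_le_of_le_one_left (norm_nonneg _) (htn k)
  have he2 : Summable fun k => ‖e (k + 2)‖ := (summable_nat_add_iff (f := fun k => ‖e k‖) 2).2 he
  have hs2 : Summable fun k => ‖(t : ℂ) ^ k • e (k + 2)‖ := by
    refine Summable.of_nonneg_of_le (fun _ => norm_nonneg _) (fun k => ?_) he2
    rw [norm_smul]
    exact mul_le_of_le_one_left (norm_nonneg _) (htn k)
  have hexp : ∑' k, (t : ℂ) ^ k • e k
      = e 0 + (t : ℂ) • e 1 + (t : ℂ) ^ 2 • ∑' k, (t : ℂ) ^ k • e (k + 2) := by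
    rw [← hs.sum_add_tsum_nat_add 2, ← hs2.of_norm.tsum_const_smul]
    congr 1
    · simp [Finset.sum_range_succ]
    · refine tsum_congr fun k => ?_
      rw [smul_smul, ← pow_add, add_comm 2 k]
  have htc : (t : ℂ) ≠ 0 := by exact_mod_cast ht0.ne'
  refine ⟨(t : ℂ)⁻¹ • (∑' k, (t : ℂ) ^ k • e k - e 0), S.smul_mem _ (S.sub_mem (h t) h0), ?_⟩
  have : e 1 - (t : ℂ)⁻¹ • (∑' k, (t : ℂ) ^ k • e k - e 0)
      = -((t : ℂ) • ∑' k, (t : ℂ) ^ k • e (k + 2)) := by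
    rw [hexp, add_assoc, add_sub_cancel_left, smul_add, inv_smul_smul₀ htc, smul_smul, sq,
      inv_mul_cancel_left₀ htc]
    abel
  rw [dist_eq_norm, this, norm_neg, norm_smul, Complex.norm_real, Real.norm_of_nonneg ht0.le]
  refine lt_of_le_of_lt (mul_le_mul_of_nonneg_left ?_ ht0.le)
    ((mul_lt_mul_of_pos_left (lt_add_one _) ht0).trans htε)
  refine (norm_tsum_le_tsum_norm hs2).trans ((hs2.tsum_le_tsum (fun k => ?_) he2).trans ?_)
  · rw [norm_smul]
    exact mul_le_of_le_one_left (norm_nonneg _) (htn k)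
  · rw [← he.sum_add_tsum_nat_add 2]
    exact le_add_of_nonneg_left (Finset.sum_nonneg fun _ _ => norm_nonneg _)

variable {H : Type*} [NormedAddCommGroup H] [InnerProductSpace ℂ H] [CompleteSpace H]

theorem isClosed_graphAlgebra (E : Set H) : IsClosed (graphAlgebra H E :
    Set ((Fock H →L[ℂ] Fock H) × (Fock H →L[ℂ] Fock H))) :=
  NonUnitalStarSubalgebra.isClosed_topologicalClosure _

/-- The set of admissible `θ` is a closed subspace containing the geometric sequences, hence all
sequences tending to zero. -/
theorem weyl_mul_numberFun_mem_graphAlgebra (u : H) (θ : ℕ →ᵇ ℂ) (hθ : Tendsto θ atTop (𝓝 0)) :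
    ((weyl u * numberFun θ, weyl u * numberFun (shift θ)) :
      (Fock H →L[ℂ] Fock H) × (Fock H →L[ℂ] Fock H)) ∈ graphAlgebra H Set.univ := by
  let L : (ℕ →ᵇ ℂ) →L[ℂ] (Fock H →L[ℂ] Fock H) × (Fock H →L[ℂ] Fock H) :=
    (ContinuousLinearMap.mul ℂ (Fock H →L[ℂ] Fock H) (weyl u) ∘L numberFunCLM H).prod
      (ContinuousLinearMap.mul ℂ (Fock H →L[ℂ] Fock H) (weyl u) ∘L numberFunCLM H ∘L shiftCLM)
  refine mem_of_geometric (S := (graphAlgebra H Set.univ).toSubmodule.comap L.toLinearMap)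
    ((isClosed_graphAlgebra Set.univ).preimage L.continuous) (fun z hz => ?_) θ hθ
  exact NonUnitalStarSubalgebra.le_topologicalClosure _
    (NonUnitalStarAlgebra.subset_adjoin ℂ _ ⟨u, trivial, z, hz, rfl⟩)

theorem weyl_zero : weyl (0 : H) = 1 := by
  refine Fock.clm_ext fun f => (hasSum_expTerm 0 f).unique ?_
  have h : ∀ k, k ≠ 0 → (expTerm (0 : H) k f : Fock H) = 0 := by
    intro k hk
    have := expTerm_real_smul 0 (0 : H) k
    rw [smul_zero, Complex.ofReal_zero, zero_pow hk] at this
    rw [this]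
    simp
  have h0 : (expTerm (0 : H) 0 f : Fock H) = f := by simp [expTerm]
  have := hasSum_single (f := fun k => (expTerm (0 : H) k f : Fock H)) 0 h
  rwa [h0] at this

theorem delta_tendsto (k : ℕ) : Tendsto (delta k) atTop (𝓝 0) := by
  refine tendsto_const_nhds.congr' (eventually_atTop.2 ⟨k + 1, fun n hn => ?_⟩)
  rw [delta_apply, if_neg (by omega)]

/-- The vacuum vector. -/
def vacuum (H : Type*) [NormedAddCommGroup H] [InnerProductSpace ℂ H] : Fock H :=
  lp.single 2 0 (SymPow.mk 0)

theorem SymPow.eq_inner_smul_mk (x : SymPow H 0) :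
    x = ⟪SymPow.mk (0 : Fin 0 → H), x⟫_ℂ • SymPow.mk (0 : Fin 0 → H) := by
  suffices h : ContinuousLinearMap.id ℂ (SymPow H 0)
      = rankOne ℂ (SymPow.mk (0 : Fin 0 → H)) (SymPow.mk (0 : Fin 0 → H)) from
    congrArg (fun T => T x) h
  refine SymPow.clm_ext fun u => ?_
  rw [Subsingleton.elim u 0, rankOne_apply, SymPow.inner_mk]
  simp

theorem numberFun_delta_zero :
    (numberFun (delta 0) : Fock H →L[ℂ] Fock H) = rankOne ℂ (vacuum H) (vacuum H) := by
  refine ContinuousLinearMap.ext fun f => lp.ext (funext fun n => ?_)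
  have h : ⟪vacuum H, f⟫_ℂ = ⟪SymPow.mk (0 : Fin 0 → H), f 0⟫_ℂ := lp.inner_single_left _ _ _
  rw [rankOne_apply, h, numberFun_apply, delta_apply, lp.coeFn_smul, Pi.smul_apply, vacuum]
  split_ifs with hn
  · subst hn
    rw [one_smul, lp.single_apply_self]
    exact SymPow.eq_inner_smul_mk _
  · rw [zero_smul, lp.single_apply_ne _ _ _ hn, smul_zero]

theorem inner_vacuum : ⟪vacuum H, vacuum H⟫_ℂ = 1 := by
  rw [vacuum, lp.inner_single_left, lp.single_apply_self, SymPow.inner_mk]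
  simp

/-- The projection onto the vacuum is `δ₀(N)`, and the shift of `δ₀` is zero. -/
theorem rankOne_vacuum_mem :
    ((rankOne ℂ (vacuum H) (vacuum H), 0) : (Fock H →L[ℂ] Fock H) × (Fock H →L[ℂ] Fock H))
      ∈ graphAlgebra H Set.univ := by
  have h := weyl_mul_numberFun_mem_graphAlgebra (0 : H) (delta 0) (delta_tendsto 0)
  have hs : numberFunCLM H (shift (delta 0)) = 0 := by
    have : shift (delta 0) = 0 := by
      ext n
      exact (if_neg (Nat.succ_ne_zero n) : (if n + 1 = 0 then (1 : ℂ) else 0) = 0)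
    rw [this, map_zero]
  rw [numberFunCLM_apply] at hs
  rwa [weyl_zero, one_mul, one_mul, hs, numberFun_delta_zero] at h

variable (H) in
/-- The vectors `f` such that the canonical endomorphism vanishes on `|f⟩⟨Ω|`. -/
def annihilatedVectors : Submodule ℂ (Fock H) :=
  (graphAlgebra H Set.univ).toSubmodule.comap
    ((LinearMap.inl ℂ (Fock H →L[ℂ] Fock H) (Fock H →L[ℂ] Fock H)) ∘ₗ
      ((ContinuousLinearMap.smulRightL ℂ (Fock H) (Fock H)) (innerSL ℂ (vacuum H))).toLinearMap)

theorem mem_annihilatedVectors {f : Fock H} : f ∈ annihilatedVectors H ↔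
    ((rankOne ℂ f (vacuum H), 0) : (Fock H →L[ℂ] Fock H) × (Fock H →L[ℂ] Fock H))
      ∈ graphAlgebra H Set.univ := Iff.rfl

theorem isClosed_annihilatedVectors : IsClosed (annihilatedVectors H : Set (Fock H)) := by
  have hc : Continuous fun f : Fock H =>
      ((rankOne ℂ f (vacuum H), 0) : (Fock H →L[ℂ] Fock H) × (Fock H →L[ℂ] Fock H)) :=
    ((ContinuousLinearMap.smulRightL ℂ (Fock H) (Fock H)
      (innerSL ℂ (vacuum H))).continuous).prodMk continuous_const
  exact (isClosed_graphAlgebra Set.univ).preimage hc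

/-- The elements of the graph with second component zero form an ideal, and `T |f⟩⟨Ω| = |T f⟩⟨Ω|`.
-/
theorem apply_mem_annihilatedVectors {x : (Fock H →L[ℂ] Fock H) × (Fock H →L[ℂ] Fock H)}
    (hx : x ∈ graphAlgebra H Set.univ) {f : Fock H} (hf : f ∈ annihilatedVectors H) :
    x.1 f ∈ annihilatedVectors H := by
  have h := mul_mem hx (mem_annihilatedVectors.1 hf)
  have e : x * (rankOne ℂ f (vacuum H), 0) = (rankOne ℂ (x.1 f) (vacuum H), 0) :=
    Prod.ext (comp_rankOne f (vacuum H) x.1) (mul_zero x.2)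
  rw [e] at h
  exact mem_annihilatedVectors.2 h

theorem numberFun_delta_single (n : ℕ) (x : SymPow H n) :
    numberFun (delta n) (lp.single 2 n x) = (lp.single 2 n x : Fock H) := by
  refine lp.ext (funext fun m => ?_)
  rw [numberFun_apply, delta_apply]
  split_ifs with h
  · exact one_smul _ _
  · rw [lp.single_apply_ne _ _ _ h, smul_zero]

theorem creationLevel_mem_annihilatedVectors (n : ℕ) (u : H) (x : SymPow H n)
    (hx : lp.single 2 n x ∈ annihilatedVectors H) :
    lp.single 2 (n + 1) (creationLevel n u x) ∈ annihilatedVectors H := by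
  let f : finiteParticle H := ⟨lp.single 2 n x, n + 1, fun m hm => lp.single_apply_ne _ _ _ (by omega)⟩
  have h1 : ∀ v : H, weyl v f ∈ annihilatedVectors H := by
    intro v
    have := apply_mem_annihilatedVectors
      (weyl_mul_numberFun_mem_graphAlgebra v _ (delta_tendsto n)) hx
    change weyl v (numberFun (delta n) (lp.single 2 n x)) ∈ _ at this
    rwa [numberFun_delta_single] at this
  have h0 : (expTerm u 0 f : Fock H) = f := by simp [expTerm]
  -- `W(tu) f` is a power series in `t` whose linear coefficient is `iφ(u) f`.
  have h2 : (expTerm u 1 f : Fock H) ∈ annihilatedVectors H := by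
    refine coeff_one_mem isClosed_annihilatedVectors (e := fun k => (expTerm u k f : Fock H))
      (summable_norm_expTerm u f) ?_ fun t => ?_
    · rw [h0]
      exact hx
    · have := hasSum_expTerm ((t : ℂ) • u) f
      simp only [expTerm_real_smul] at this
      rw [show (fun k => (t : ℂ) ^ k • (expTerm u k f : Fock H)) = fun k =>
        ((((t : ℂ) ^ k • expTerm u k) f : finiteParticle H) : Fock H) from rfl, this.tsum_eq]
      exact h1 _
  -- The projection onto `n + 1` particles keeps the creation part of `φ(u) f` and removes the
  -- annihilation part.
  have h3 := apply_mem_annihilatedVectors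
    (weyl_mul_numberFun_mem_graphAlgebra (0 : H) _ (delta_tendsto (n + 1))) h2
  rw [weyl_zero, one_mul] at h3
  have e : numberFun (delta (n + 1)) (expTerm u 1 f : Fock H)
      = Complex.I • (lp.single 2 (n + 1) (creationLevel n u x) : Fock H) := by
    have h4 : expTerm u 1 f = Complex.I • field u f := by simp [expTerm]
    rw [h4]
    refine lp.ext (funext fun m => ?_)
    rw [numberFun_apply, delta_apply, lp.coeFn_smul, Pi.smul_apply]
    split_ifs with h
    · subst h
      rw [one_smul, lp.single_apply_self]
      change Complex.I • (ContinuousLinearMap.adjoint (creationLevel (n + 1) u)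
        (lp.single (E := fun n => SymPow H n) 2 n x (n + 1 + 1))
        + creationLevel n u (lp.single (E := fun n => SymPow H n) 2 n x n)) = _
      rw [lp.single_apply_self, lp.single_apply_ne _ _ _ (by omega), map_zero, zero_add]
    · rw [zero_smul, lp.single_apply_ne _ _ _ h, smul_zero]
  change numberFun (delta (n + 1)) (expTerm u 1 f : Fock H) ∈ _ at h3
  rw [e] at h3
  have := (annihilatedVectors H).smul_mem (Complex.I)⁻¹ h3
  rwa [inv_smul_smul₀ Complex.I_ne_zero] at this

theorem mem_annihilatedVectors_all (f : Fock H) : f ∈ annihilatedVectors H := by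
  refine Fock.mem_of_mk isClosed_annihilatedVectors (fun n => ?_) f
  induction n with
  | zero =>
    intro u
    rw [Subsingleton.elim u 0]
    exact rankOne_vacuum_mem
  | succ n ih =>
    intro u
    rw [SymPow.mk_eq_creationLevel u 0]
    exact creationLevel_mem_annihilatedVectors n _ _ (ih _)

/-- `|f⟩⟨g| = |f⟩⟨Ω| (|g⟩⟨Ω|)*`, because the vacuum has norm one. -/
theorem rankOne_mem_graphAlgebra (f g : Fock H) :
    ((rankOne ℂ f g, 0) : (Fock H →L[ℂ] Fock H) × (Fock H →L[ℂ] Fock H))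
      ∈ graphAlgebra H Set.univ := by
  have h := mul_mem (mem_annihilatedVectors.1 (mem_annihilatedVectors_all f))
    (star_mem (mem_annihilatedVectors.1 (mem_annihilatedVectors_all g)))
  have e : ((rankOne ℂ f (vacuum H), 0) : (Fock H →L[ℂ] Fock H) × (Fock H →L[ℂ] Fock H))
      * star (rankOne ℂ g (vacuum H), 0) = (rankOne ℂ f g, 0) := by
    refine Prod.ext ?_ (zero_mul _)
    change rankOne ℂ f (vacuum H) ∘L ContinuousLinearMap.adjoint (rankOne ℂ g (vacuum H)) = _
    rw [adjoint_rankOne, rankOne_comp_rankOne, inner_vacuum, one_smul]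
  rwa [e] at h

/-- The canonical endomorphism vanishes on compact operators. -/
theorem mem_graphAlgebra_of_isCompactOperator {T : Fock H →L[ℂ] Fock H}
    (hT : IsCompactOperator T) :
    ((T, 0) : (Fock H →L[ℂ] Fock H) × (Fock H →L[ℂ] Fock H)) ∈ graphAlgebra H Set.univ := by
  refine mem_of_isCompactOperator (S := (graphAlgebra H Set.univ).toSubmodule.comap
    (LinearMap.inl ℂ (Fock H →L[ℂ] Fock H) (Fock H →L[ℂ] Fock H)))
    ?_ rankOne_mem_graphAlgebra hT
  exact (isClosed_graphAlgebra Set.univ).preimage (continuous_id.prodMk continuous_const)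

end CompactOperators

/-! ### The canonical endomorphism, its uniqueness and range, and the quotient. -/

section CanonicalEndomorphism

set_option linter.unusedSectionVars false

open Filter Topology
open scoped BoundedContinuousFunction ZeroAtInfty

variable {H : Type*} [NormedAddCommGroup H] [InnerProductSpace ℂ H] [CompleteSpace H]

theorem isClosed_scalarFieldAlgebra :
    IsClosed (scalarFieldAlgebra H : Set (Fock H →L[ℂ] Fock H)) :=
  NonUnitalStarSubalgebra.isClosed_topologicalClosure _

theorem fst_mem_scalarFieldAlgebra [Nontrivial H]
    {x : (Fock H →L[ℂ] Fock H) × (Fock H →L[ℂ] Fock H)} (hx : x ∈ graphAlgebra H Set.univ) :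
    x.1 ∈ scalarFieldAlgebra H := by
  refine NonUnitalStarSubalgebra.topologicalClosure_minimal
    (t := (scalarFieldAlgebra H).comap (NonUnitalStarAlgHom.fst ℂ
      (Fock H →L[ℂ] Fock H) (Fock H →L[ℂ] Fock H))) _ ?_
    (isClosed_scalarFieldAlgebra.preimage continuous_fst) hx
  refine NonUnitalStarAlgebra.adjoin_le fun y hy => ?_
  change y.1 ∈ scalarFieldAlgebra H
  rw [scalarFieldAlgebra_eq]
  exact NonUnitalStarSubalgebra.le_topologicalClosure _
    (NonUnitalStarAlgebra.subset_adjoin ℂ _ ⟨y, hy, rfl⟩)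

theorem snd_mem_scalarFieldAlgebra [Nontrivial H]
    {x : (Fock H →L[ℂ] Fock H) × (Fock H →L[ℂ] Fock H)} (hx : x ∈ graphAlgebra H Set.univ) :
    x.2 ∈ scalarFieldAlgebra H := by
  refine NonUnitalStarSubalgebra.topologicalClosure_minimal
    (t := (scalarFieldAlgebra H).comap (NonUnitalStarAlgHom.snd ℂ
      (Fock H →L[ℂ] Fock H) (Fock H →L[ℂ] Fock H))) _ ?_
    (isClosed_scalarFieldAlgebra.preimage continuous_snd) hx
  refine NonUnitalStarAlgebra.adjoin_le fun y hy => ?_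
  obtain ⟨u, -, z, hz, rfl⟩ := hy
  change weyl u * numberFun (shift (geometric z hz)) ∈ scalarFieldAlgebra H
  -- The shift acts on a geometric sequence as multiplication by `z`, so images of generators stay
  -- in `A(H)`.
  have e : shift (geometric z hz) = z • geometric z hz := by
    ext n
    exact pow_succ' z n
  have h := map_smul (numberFunCLM H) z (geometric z hz)
  rw [numberFunCLM_apply, numberFunCLM_apply] at h
  rw [e, h, mul_smul_comm]
  exact SMulMemClass.smul_mem z (fst_mem_scalarFieldAlgebra
    (weyl_mul_numberFun_mem_graphAlgebra u _ (tendsto_geometric z hz)))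

/-- As the second component is dominated by the first, the first projection of the graph is
isometric. Its range is then closed, and it contains the generators. -/
theorem exists_mem_graphAlgebra (hH : ¬ FiniteDimensional ℂ H) [Nontrivial H]
    {T : Fock H →L[ℂ] Fock H} (hT : T ∈ scalarFieldAlgebra H) :
    ∃ T', ((T, T') : (Fock H →L[ℂ] Fock H) × (Fock H →L[ℂ] Fock H))
      ∈ graphAlgebra H Set.univ := by
  have : CompleteSpace (graphAlgebra H (Set.univ : Set H)) :=
    (isClosed_graphAlgebra (Set.univ : Set H)).completeSpace_coe
  let φ : graphAlgebra H (Set.univ : Set H) →⋆ₙₐ[ℂ] (Fock H →L[ℂ] Fock H) :=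
    (NonUnitalStarAlgHom.fst ℂ _ _).comp (NonUnitalStarSubalgebraClass.subtype _)
  have hφ : Isometry φ := AddMonoidHomClass.isometry_of_norm φ fun x =>
    (max_eq_left (norm_snd_le_of_mem_graphAlgebra hH x.2)).symm
  rw [scalarFieldAlgebra_eq] at hT
  obtain ⟨x, hx⟩ : T ∈ NonUnitalStarAlgHom.range φ := by
    refine NonUnitalStarSubalgebra.topologicalClosure_minimal _ ?_ ?_ hT
    · refine NonUnitalStarAlgebra.adjoin_le ?_
      rintro _ ⟨y, hy, rfl⟩
      exact ⟨⟨y, NonUnitalStarSubalgebra.le_topologicalClosure _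
        (NonUnitalStarAlgebra.subset_adjoin ℂ _ hy)⟩, rfl⟩
    · rw [NonUnitalStarAlgHom.coe_range]
      exact hφ.isClosedEmbedding.isClosed_range
  exact ⟨x.1.2, by rw [← hx]; exact x.2⟩

/-- The difference of the two pairs is `(0, S - S')`, and the second component is dominated by the
first. -/
theorem eq_of_mem_graphAlgebra (hH : ¬ FiniteDimensional ℂ H) {T S S' : Fock H →L[ℂ] Fock H}
    (hS : ((T, S) : (Fock H →L[ℂ] Fock H) × (Fock H →L[ℂ] Fock H)) ∈ graphAlgebra H Set.univ)
    (hS' : ((T, S') : (Fock H →L[ℂ] Fock H) × (Fock H →L[ℂ] Fock H)) ∈ graphAlgebra H Set.univ) :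
    S = S' := by
  have h := norm_snd_le_of_mem_graphAlgebra hH (sub_mem hS hS')
  change ‖S - S'‖ ≤ ‖T - T‖ at h
  rw [sub_self, norm_zero] at h
  exact sub_eq_zero.1 (norm_le_zero_iff.1 h)

theorem star_mem_graphAlgebra {S T : Fock H →L[ℂ] Fock H}
    (h : ((S, T) : (Fock H →L[ℂ] Fock H) × (Fock H →L[ℂ] Fock H)) ∈ graphAlgebra H Set.univ) :
    ((star S, star T) : (Fock H →L[ℂ] Fock H) × (Fock H →L[ℂ] Fock H))
      ∈ graphAlgebra H Set.univ := by
  have h' := (graphAlgebra H Set.univ).star_mem' h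
  exact h'

/-- The underlying map of the canonical endomorphism. -/
def canonicalMap (hH : ¬ FiniteDimensional ℂ H) [Nontrivial H] (T : scalarFieldAlgebra H) :
    scalarFieldAlgebra H :=
  ⟨(exists_mem_graphAlgebra hH T.2).choose,
    snd_mem_scalarFieldAlgebra (exists_mem_graphAlgebra hH T.2).choose_spec⟩

theorem mem_canonicalMap (hH : ¬ FiniteDimensional ℂ H) [Nontrivial H]
    (T : scalarFieldAlgebra H) : (((T : Fock H →L[ℂ] Fock H),
      (canonicalMap hH T : Fock H →L[ℂ] Fock H)) :
        (Fock H →L[ℂ] Fock H) × (Fock H →L[ℂ] Fock H)) ∈ graphAlgebra H Set.univ :=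
  (exists_mem_graphAlgebra hH T.2).choose_spec

theorem canonicalMap_eq (hH : ¬ FiniteDimensional ℂ H) [Nontrivial H]
    {S T : scalarFieldAlgebra H} (h : (((S : Fock H →L[ℂ] Fock H), (T : Fock H →L[ℂ] Fock H)) :
        (Fock H →L[ℂ] Fock H) × (Fock H →L[ℂ] Fock H)) ∈ graphAlgebra H Set.univ) :
    canonicalMap hH S = T :=
  Subtype.ext (eq_of_mem_graphAlgebra hH (mem_canonicalMap hH S) h)

/-- The canonical endomorphism. -/
def canonicalEndomorphism (hH : ¬ FiniteDimensional ℂ H) [Nontrivial H] :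
    scalarFieldAlgebra H →⋆ₙₐ[ℂ] scalarFieldAlgebra H where
  toFun := canonicalMap hH
  map_smul' c T := canonicalMap_eq hH (SMulMemClass.smul_mem c (mem_canonicalMap hH T))
  map_zero' := canonicalMap_eq hH (zero_mem _)
  map_add' S T := canonicalMap_eq hH (add_mem (mem_canonicalMap hH S) (mem_canonicalMap hH T))
  map_mul' S T := canonicalMap_eq hH (mul_mem (mem_canonicalMap hH S) (mem_canonicalMap hH T))
  map_star' T := canonicalMap_eq hH (star_mem_graphAlgebra (mem_canonicalMap hH T))

theorem mem_graphAlgebra_iff (hH : ¬ FiniteDimensional ℂ H) [Nontrivial H]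
    (T : scalarFieldAlgebra H) (S : Fock H →L[ℂ] Fock H) :
    (((T : Fock H →L[ℂ] Fock H), S) : (Fock H →L[ℂ] Fock H) × (Fock H →L[ℂ] Fock H))
      ∈ graphAlgebra H Set.univ ↔ (canonicalEndomorphism hH T : Fock H →L[ℂ] Fock H) = S := by
  have h := mem_canonicalMap hH T
  constructor
  · exact fun hS => eq_of_mem_graphAlgebra hH h hS
  · rintro rfl
    exact h

theorem isCanonical_canonicalEndomorphism (hH : ¬ FiniteDimensional ℂ H) [Nontrivial H] :
    IsCanonical (canonicalEndomorphism hH) := by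
  intro u θ T hT
  rw [← mem_graphAlgebra_iff, hT]
  exact weyl_mul_numberFun_mem_graphAlgebra u _ (tendsto_toBCF θ)

theorem weyl_mul_numberFun_mem [Nontrivial H] (u : H) (θ : C₀(ℕ, ℂ)) :
    weyl u * numberFun θ.toBCF ∈ scalarFieldAlgebra H :=
  fst_mem_scalarFieldAlgebra (weyl_mul_numberFun_mem_graphAlgebra u _ (tendsto_toBCF θ))

/-- A vanishing sequence as an element of `C₀(ℕ)`. -/
def zeroAtInfty (θ : ℕ →ᵇ ℂ) (hθ : Tendsto θ atTop (𝓝 0)) : C₀(ℕ, ℂ) where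
  toFun := θ
  continuous_toFun := θ.continuous
  zero_at_infty' := by rwa [Filter.cocompact_eq_cofinite, Nat.cofinite_eq_atTop]

/-- A closed subalgebra of `A(H)` containing the operators `W(u) z^N` is everything. -/
theorem eq_top_of_generators_mem [Nontrivial H]
    {S : NonUnitalStarSubalgebra ℂ (scalarFieldAlgebra H)}
    (hS : IsClosed (S : Set (scalarFieldAlgebra H)))
    (h : ∀ (u : H) (z : ℂ) (hz : ‖z‖ < 1) (T : scalarFieldAlgebra H),
      (T : Fock H →L[ℂ] Fock H) = weyl u * numberFun (geometric z hz) → T ∈ S)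
    (T : scalarFieldAlgebra H) : T ∈ S := by
  have hle : scalarFieldAlgebra H ≤ S.map (NonUnitalStarSubalgebraClass.subtype _) := by
    refine (scalarFieldAlgebra_eq (H := H)).le.trans
      (NonUnitalStarSubalgebra.topologicalClosure_minimal _ (NonUnitalStarAlgebra.adjoin_le ?_) ?_)
    · rintro _ ⟨_, ⟨u, -, z, hz, rfl⟩, rfl⟩
      have hm := fst_mem_scalarFieldAlgebra
        (weyl_mul_numberFun_mem_graphAlgebra u _ (tendsto_geometric z hz))
      exact ⟨⟨_, hm⟩, h u z hz ⟨_, hm⟩ rfl, rfl⟩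
    · rw [NonUnitalStarSubalgebra.coe_map]
      exact isClosed_scalarFieldAlgebra.isClosedEmbedding_subtypeVal.isClosedMap _ hS
  obtain ⟨T', hT', e⟩ := hle T.2
  rwa [← Subtype.ext e]

/-- Morphisms of C*-algebras are continuous, so their equalizer is a closed subalgebra; it contains
the generators. -/
theorem eq_of_isCanonical [Nontrivial H]
    {P P' : scalarFieldAlgebra H →⋆ₙₐ[ℂ] scalarFieldAlgebra H} (hP : IsCanonical P)
    (hP' : IsCanonical P') : P' = P := by
  have := isClosed_scalarFieldAlgebra (H := H)
  refine NonUnitalStarAlgHom.ext fun T => ?_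
  refine eq_top_of_generators_mem (S := NonUnitalStarAlgHom.equalizer P' P)
    (isClosed_eq (continuous_starHom P') (continuous_starHom P)) (fun u z hz T hT => ?_) T
  change P' T = P T
  refine Subtype.ext ?_
  rw [hP u (zeroAtInfty _ (tendsto_geometric z hz)) T hT,
    hP' u (zeroAtInfty _ (tendsto_geometric z hz)) T hT]

/-- The range is a closed subalgebra, so it is enough to reach the generators, that is, to write
`zⁿ` as the shift of a sequence tending to zero. -/
theorem surjective_of_isCanonical [Nontrivial H]
    {P : scalarFieldAlgebra H →⋆ₙₐ[ℂ] scalarFieldAlgebra H} (hP : IsCanonical P) :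
    Function.Surjective P := by
  have := isClosed_scalarFieldAlgebra (H := H)
  intro T
  refine eq_top_of_generators_mem (S := NonUnitalStarAlgHom.range P) ?_ (fun u z hz T hT => ?_) T
  · rw [NonUnitalStarAlgHom.coe_range]
    exact isClosed_range_starHom P
  · obtain ⟨θ, hθ, hs⟩ : ∃ θ : ℕ →ᵇ ℂ, Tendsto θ atTop (𝓝 0) ∧ shift θ = geometric z hz := by
      -- For `z = 0` the convention `0⁰ = 1` makes the sequence equal to `δ₀`, which is the shift of
      -- `δ₁`; otherwise `z⁻¹ zⁿ` works.
      by_cases h0 : z = 0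
      · refine ⟨delta 1, delta_tendsto 1, ?_⟩
        ext n
        change (if n + 1 = 1 then (1 : ℂ) else 0) = z ^ n
        rw [h0, zero_pow_eq]
        simp
      · refine ⟨z⁻¹ • geometric z hz, ?_, ?_⟩
        · have := (tendsto_geometric z hz).const_smul z⁻¹
          rwa [smul_zero] at this
        · ext n
          change z⁻¹ * z ^ (n + 1) = z ^ n
          rw [pow_succ', inv_mul_cancel_left₀ h0]
    refine ⟨⟨_, weyl_mul_numberFun_mem u (zeroAtInfty θ hθ)⟩, Subtype.ext ?_⟩
    rw [hT, ← hs]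
    exact hP u (zeroAtInfty θ hθ) _ rfl

theorem canonicalEndomorphism_eq_zero_iff (hH : ¬ FiniteDimensional ℂ H) [Nontrivial H]
    (T : scalarFieldAlgebra H) :
    canonicalEndomorphism hH T = 0 ↔ IsCompactOperator (T : Fock H →L[ℂ] Fock H) := by
  rw [← Subtype.coe_inj]
  change (canonicalEndomorphism hH T : Fock H →L[ℂ] Fock H) = 0 ↔ _
  rw [← mem_graphAlgebra_iff]
  exact ⟨isCompactOperator_of_mem_graphAlgebra, mem_graphAlgebra_of_isCompactOperator⟩

theorem CompactQuotient.mk_eq_mk {S T : scalarFieldAlgebra H} :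
    CompactQuotient.mk S = CompactQuotient.mk T ↔
      IsCompactOperator ((S - T : scalarFieldAlgebra H) : Fock H →L[ℂ] Fock H) :=
  (RingCon.eq _).trans compactIdeal_ringCon_iff

/-- The isomorphism induced on the quotient by a surjective endomorphism whose kernel consists of
the compact operators. -/
def CompactQuotient.lift (P : scalarFieldAlgebra H →⋆ₙₐ[ℂ] scalarFieldAlgebra H)
    (hP : Function.Surjective P)
    (hK : ∀ T, P T = 0 ↔ IsCompactOperator (T : Fock H →L[ℂ] Fock H)) :
    CompactQuotient H ≃⋆ₐ[ℂ] scalarFieldAlgebra H :=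
  let f : CompactQuotient H → scalarFieldAlgebra H := Quotient.lift P fun S T h => by
    rw [← sub_eq_zero, ← map_sub]
    exact (hK _).2 (compactIdeal_ringCon_iff.1 h)
  have hf : Function.Bijective f := by
    refine ⟨?_, fun T => ?_⟩
    · rintro ⟨S⟩ ⟨T⟩ h
      refine CompactQuotient.mk_eq_mk.2 ((hK _).1 ?_)
      rw [map_sub, sub_eq_zero]
      exact h
    · obtain ⟨S, hS⟩ := hP T
      exact ⟨CompactQuotient.mk S, hS⟩
  { Equiv.ofBijective f hf with
    map_mul' := by
      rintro ⟨S⟩ ⟨T⟩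
      exact map_mul P S T
    map_add' := by
      rintro ⟨S⟩ ⟨T⟩
      exact map_add P S T
    map_star' := by
      rintro ⟨T⟩
      exact map_star P T
    map_smul' := by
      rintro c ⟨T⟩
      exact map_smul P c T }

/-- The infimum defining the quotient norm is attained at a lift of `P T` of the same norm; no
representative can do better, since `P` is contractive. -/
theorem CompactQuotient.norm_lift (P : scalarFieldAlgebra H →⋆ₙₐ[ℂ] scalarFieldAlgebra H)
    (hP : Function.Surjective P)
    (hK : ∀ T, P T = 0 ↔ IsCompactOperator (T : Fock H →L[ℂ] Fock H)) (q : CompactQuotient H) :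
    ‖CompactQuotient.lift P hP hK q‖ = ‖q‖ := by
  have := isClosed_scalarFieldAlgebra (H := H)
  obtain ⟨T⟩ := q
  refine (IsLeast.csInf_eq ⟨?_, ?_⟩).symm
  · obtain ⟨S, hS, hn⟩ := exists_norm_le_of_starHom P T
    refine ⟨S, CompactQuotient.mk_eq_mk.2 ((hK _).1 (by rw [map_sub, hS, sub_self])), ?_⟩
    refine le_antisymm hn ?_
    change ‖P T‖ ≤ _
    rw [← hS]
    exact NonUnitalStarAlgHom.norm_apply_le P S
  · rintro _ ⟨S, hS, rfl⟩
    have h := (hK _).2 (CompactQuotient.mk_eq_mk.1 hS)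
    rw [map_sub, sub_eq_zero] at h
    change ‖P T‖ ≤ _
    rw [← h]
    exact NonUnitalStarAlgHom.norm_apply_le P S

end CanonicalEndomorphism

end

end BoseFock

theorem mainTheorem2 {H : Type*} [NormedAddCommGroup H] [InnerProductSpace ℂ H] [CompleteSpace H]
    (hH : ¬ FiniteDimensional ℂ H) :
    (∀ (u : H) (θ : ZeroAtInftyContinuousMap ℕ ℂ),
      BoseFock.weyl u * BoseFock.numberFun θ.toBCF ∈ BoseFock.scalarFieldAlgebra H) ∧
    ∃ P : BoseFock.scalarFieldAlgebra H →⋆ₙₐ[ℂ] BoseFock.scalarFieldAlgebra H,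
      BoseFock.IsCanonical P ∧
      (∀ P' : BoseFock.scalarFieldAlgebra H →⋆ₙₐ[ℂ] BoseFock.scalarFieldAlgebra H,
        BoseFock.IsCanonical P' → P' = P) ∧
      Function.Surjective P ∧
      {T : BoseFock.Fock H →L[ℂ] BoseFock.Fock H |
          ∃ hT : T ∈ BoseFock.scalarFieldAlgebra H, P ⟨T, hT⟩ = 0} =
        {T : BoseFock.Fock H →L[ℂ] BoseFock.Fock H | IsCompactOperator T} ∧
      ∃ Φ : BoseFock.CompactQuotient H ≃⋆ₐ[ℂ] BoseFock.scalarFieldAlgebra H,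
        (∀ T : BoseFock.scalarFieldAlgebra H, Φ (BoseFock.CompactQuotient.mk T) = P T) ∧
        ∀ q : BoseFock.CompactQuotient H, ‖Φ q‖ = ‖q‖ := by
  have : Nontrivial H := by
    by_contra h
    rw [not_nontrivial_iff_subsingleton] at h
    exact hH inferInstance
  have hP := BoseFock.isCanonical_canonicalEndomorphism hH
  have hs := BoseFock.surjective_of_isCanonical hP
  have hK := BoseFock.canonicalEndomorphism_eq_zero_iff hH
  refine ⟨BoseFock.weyl_mul_numberFun_mem, BoseFock.canonicalEndomorphism hH, hP,
    fun P' hP' => BoseFock.eq_of_isCanonical hP hP', hs, Set.ext fun T => ?_,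
    BoseFock.CompactQuotient.lift _ hs hK, fun T => rfl, BoseFock.CompactQuotient.norm_lift _ hs hK⟩
  constructor
  · rintro ⟨hT, h⟩
    exact (hK ⟨T, hT⟩).1 h
  · intro h
    have hT := BoseFock.fst_mem_scalarFieldAlgebra
      (BoseFock.mem_graphAlgebra_of_isCompactOperator h)
    exact ⟨hT, (hK ⟨T, hT⟩).2 h⟩
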